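/- **Setting.** Let $\Omega\subset\mathbb R^n$ be compact, let $\mathcal C=C(\Omega,\mathbb R)$ carry the sup norm, and let $\pi$ be the law of a random observation $o\in\mathcal C^*$ which is a centered Gaussian (every $o(f)$, $f\in\mathcal C$, is a centered Gaussian variable; hence so is every vector $(o(f_1),\dots,o(f_r))$) and for which $\langle f,g\rangle_S=\mathbb E_{o\sim\pi}[o(f)o(g)]$ is a scalar product on $\mathcal C$. Let $K:\Omega\times\Omega\to\mathbb R$ be a continuous positive kernel that is diagonalized by a countable $\langle\cdot,\cdot\rangle_S$-orthonormal family $(f^{(k)})_k$ in $\mathcal C$ with eigenvalues $d_k\ge 0$, $\sum_k d_k<\infty$, i.e. $K(x,x')=\sum_k d_k f^{(k)}(x)f^{(k)}(x')$ uniformly. Let $(T_Kf)(x)=\langle f,K(x,\cdot)\rangle_S$, and for an operator $M$ on $\mathcal C$ let $\mathrm{Tr}[M]=\sum_k\langle f^{(k)},Mf^{(k)}\rangle_S$, so that $\mathrm{Tr}[T_K]=\sum_k d_k$. Let $N\ge 1$, let $o_1,\dots,o_N$ be i.i.d. with law $\pi$, let $\mathcal O_{\cdot k}=(o_i(f^{(k)}))_{i\le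 N}$, and let $G=\big(o_i(K o_j)\big)_{i,j\le N}$ be the Gram matrix, where $(K\mu)(x)=\mu(K(x,\cdot))$. For $\Re z<0$ put $$m_G(z)=\tfrac1N\mathrm{Tr}\big[(\tfrac1N G-zI_N)^{-1}\big],\qquad g_k(z)=\tfrac1N\,\mathcal O_{\cdot k}^T\big(\tfrac1N G_{(k)}-zI_N\big)^{-1}\mathcal O_{\cdot k},$$ where $G_{(k)}$ is the Gram matrix of the kernel $K_{(k)}=K-d_kf^{(k)}\otimes f^{(k)}$. **Statement.** For every $s\in\mathbb N$ there is a constant $\boldsymbol c_s>0$ depending only on $s$ such that in every such setting the following holds. 1. For every $\lambda>0$ the equation $\vartheta=\lambda+\frac{\vartheta}{N}\mathrm{Tr}\big[T_K(T_K+\vartheta I)^{-1}\big]$ has a unique positive solution $\vartheta=\vartheta(\lambda)$ (the Signal Capture Threshold), and $$\mathbb E\Big[\big|\tfrac1{\vartheta(\lambda)}-m_G(-\lambda)\big|^{2s}\Big]\le\frac{\boldsymbol c_s(\mathrm{Tr}[T_K])^{2s}}{\lambda^{4s}N^{3s}}.$$ 2. For every $z\in\mathbb C$ with $\Re z<0$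 the equation $\tilde m=-\frac1z\Big(1-\frac1N\sum_k\frac{d_k\tilde m}{1+d_k\tilde m}\Big)$ has a unique solution $\tilde m=\tilde m(z)$ in the cone $\{a-b/z: a,b\ge0\}$, and for every $k$ $$\mathbb E\big[|\tilde m-m_G(z)|^{2s}\big]\le\frac{\boldsymbol c_s(\mathrm{Tr}[T_K])^{2s}}{|z|^{4s}N^{3s}},\qquad \mathbb E\big[|\tilde m-g_k(z)|^{2s}\big]\le\frac{2^{2s-1}\boldsymbol c_s(\mathrm{Tr}[T_K])^{2s}}{|z|^{4s}N^{3s}}+\frac{2^{2s-1}\boldsymbol c_s}{|z|^{2s}N^s},$$ where $\boldsymbol c_s$ is also a constant for which $\mathbb E\big[|m_G(z)-g_k(z)|^{2s}\big]\le\frac{\boldsymbol c_s}{|z|^{2s}N^s}$. All the moments in question are finite. -/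

import Mathlib

open MeasureTheory ProbabilityTheory Filter Topology

noncomputable section

namespace KRR

/-- Observations of continuous functions: the elements of the dual space `C(X, ℝ)*`. -/
abbrev Observation (X : Type*) [TopologicalSpace X] [CompactSpace X] : Type _ :=
  WeakDual ℝ C(X, ℝ)

/-- The σ-algebra on observations generated by the evaluations `o ↦ o f`. -/
instance Observation.instMeasurableSpace (X : Type*) [TopologicalSpace X] [CompactSpace X] :
    MeasurableSpace (Observation X) :=
  ⨆ f : C(X, ℝ), MeasurableSpace.comap (fun o : Observation X => o f) (borel ℝ)

section Setting

variable {X : Type*} [TopologicalSpace X] [CompactSpace X]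

/-- `⟨f, g⟩_S = 𝔼_{o ∼ π} [o(f) o(g)]`. -/
def innerS (π : Measure (Observation X)) (f g : C(X, ℝ)) : ℝ :=
  ∫ o, o f * o g ∂π

/-- The law `π` of an observation is centered Gaussian and `⟨·, ·⟩_S` is a scalar product.
As `o ↦ o f` is linear in `f`, the first field says that all finite families `(o f₁, …, o fₙ)`
are Gaussian vectors. -/
structure IsGaussianObservation (π : Measure (Observation X)) : Prop where
  gaussian : ∀ f : C(X, ℝ), HasGaussianLaw (fun o : Observation X => o f) π
  centered : ∀ f : C(X, ℝ), ∫ o, o f ∂π = 0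
  definite : ∀ f : C(X, ℝ), innerS π f f = 0 → f = 0

/-- A kernel, viewed as the map `C* → C`, `(K μ)(x) = μ (K(x, ·))`. -/
def kernelMap (K : C(X × X, ℝ)) (μ : Observation X) : C(X, ℝ) :=
  ⟨fun x => μ (K.curry x), (WeakDual.toStrongDual μ).continuous.comp K.curry.continuous⟩

/-- `f ⊗ g`, the kernel `(x, y) ↦ f x * g y`. -/
def tensor (f g : C(X, ℝ)) : C(X × X, ℝ) :=
  ⟨fun p => f p.1 * g p.2, by fun_prop⟩

/-! ### The integral operator -/

/-- The map `C → L²(π)`, `f ↦ (o ↦ o f)`. -/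
def toL2 {π : Measure (Observation X)} (hπ : IsGaussianObservation π) :
    C(X, ℝ) →ₗ[ℝ] Lp ℝ 2 π where
  toFun f := (hπ.gaussian f).memLp_two.toLp
  map_add' f g := by
    rw [← MemLp.toLp_add]
    exact MemLp.toLp_congr _ _ (Eventually.of_forall fun o => map_add o f g)
  map_smul' c f := by
    rw [RingHom.id_apply, ← MemLp.toLp_const_smul]
    exact MemLp.toLp_congr _ _ (Eventually.of_forall fun o => map_smul o c f)

theorem toL2_coe {π : Measure (Observation X)} (hπ : IsGaussianObservation π) (f : C(X, ℝ)) :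
    toL2 hπ f =ᵐ[π] fun o => o f :=
  (hπ.gaussian f).memLp_two.coeFn_toLp

theorem innerS_eq {π : Measure (Observation X)} (hπ : IsGaussianObservation π) (f g : C(X, ℝ)) :
    innerS π f g = inner ℝ (toL2 hπ f) (toL2 hπ g) := by
  rw [L2.inner_def]
  refine integral_congr_ae ?_
  filter_upwards [toL2_coe hπ f, toL2_coe hπ g] with o h1 h2
  simp [h1, h2, mul_comm]

theorem continuous_toL2 {π : Measure (Observation X)} (hπ : IsGaussianObservation π) :
    Continuous (toL2 hπ) := by
  refine (toL2 hπ).continuous_of_seq_closed_graph fun u f y hu hy => ?_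
  obtain ⟨φ, hφ, hae⟩ := (tendstoInMeasure_of_tendsto_Lp hy).exists_seq_tendsto_ae
  apply Lp.ext
  have h1 : ∀ᵐ o ∂π, ∀ n, toL2 hπ (u n) o = o (u n) := ae_all_iff.2 fun n => toL2_coe hπ (u n)
  filter_upwards [hae, h1, toL2_coe hπ f] with o h2 h3 h4
  rw [h4]
  refine tendsto_nhds_unique h2 ?_
  simp only [Function.comp_apply, h3]
  exact (((WeakDual.toStrongDual o).continuous.tendsto f).comp hu).comp hφ.tendsto_atTop

theorem continuous_innerS {π : Measure (Observation X)} (hπ : IsGaussianObservation π)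
    (f : C(X, ℝ)) : Continuous fun g => innerS π f g := by
  simp only [innerS_eq hπ]
  exact continuous_const.inner (continuous_toL2 hπ)

/-- The integral operator `T_K : C → C`,
`(T_K f)(x) = ⟨f, K(x, ·)⟩_S = 𝔼_{o ∼ π} [o(f) o(K(x, ·))]`. -/
def integralOperator {π : Measure (Observation X)} (hπ : IsGaussianObservation π)
    (K : C(X × X, ℝ)) : Module.End ℝ C(X, ℝ) where
  toFun f := ⟨fun x => innerS π f (K.curry x), (continuous_innerS hπ f).comp K.curry.continuous⟩
  map_add' f g := by
    ext x
    simp only [innerS_eq hπ, ContinuousMap.coe_mk, ContinuousMap.add_apply, map_add,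
      inner_add_left]
  map_smul' c f := by
    ext x
    simp only [innerS_eq hπ, ContinuousMap.coe_mk, ContinuousMap.smul_apply, map_smul,
      inner_smul_left, RingHom.id_apply, smul_eq_mul]
    rfl

/-- The trace `∑ₖ ⟨f⁽ᵏ⁾, M f⁽ᵏ⁾⟩_S` of an operator on `C` with respect to the family `f⁽ᵏ⁾`. -/
def traceS {ι : Type*} (π : Measure (Observation X)) (f : ι → C(X, ℝ))
    (M : Module.End ℝ C(X, ℝ)) : ℝ :=
  ∑' k, innerS π (f k) (M (f k))

/-- `K` is a positive kernel of finite trace that is diagonalized by the `S`-orthonormal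
family `f⁽ᵏ⁾` with eigenvalues `d k`: `K = ∑ₖ d k • f⁽ᵏ⁾ ⊗ f⁽ᵏ⁾`, the convergence being that of
`C(X × X, ℝ)`, that is, uniform. (Positivity of the kernel is the nonnegativity of the `d k`.) -/
structure IsDiagonalization {ι : Type*} (π : Measure (Observation X)) (K : C(X × X, ℝ))
    (d : ι → ℝ) (f : ι → C(X, ℝ)) : Prop where
  nonneg : ∀ k, 0 ≤ d k
  summable : Summable d
  norm_one : ∀ k, innerS π (f k) (f k) = 1
  orthogonal : ∀ k l, k ≠ l → innerS π (f k) (f l) = 0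
  hasSum : HasSum (fun k => d k • tensor (f k) (f k)) K

/-- `ϑ` is a positive solution of
`ϑ = lam + (ϑ / N) Tr[T_K (T_K + ϑ I)⁻¹]`. -/
def IsSCT {ι : Type*} {π : Measure (Observation X)} (hπ : IsGaussianObservation π)
    (K : C(X × X, ℝ)) (f : ι → C(X, ℝ)) (N : ℕ) (lam ϑ : ℝ) : Prop :=
  0 < ϑ ∧
    ϑ = lam + ϑ / N *
      traceS π f (integralOperator hπ K * Ring.inverse (integralOperator hπ K + ϑ • 1))

/-- `w` lies in the cone spanned by `1` and `-1/z` and solves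
`w = -(1/z) (1 - (1/N) ∑ₖ d k w / (1 + d k w))`. -/
def IsFixedPoint {ι : Type*} (d : ι → ℝ) (N : ℕ) (z w : ℂ) : Prop :=
  (∃ a b : ℝ, 0 ≤ a ∧ 0 ≤ b ∧ w = a - b * (1 / z)) ∧
    w = -(1 / z) * (1 - 1 / N * ∑' k, d k * w / (1 + d k * w))

/-! ### The Gram matrix and its Stieltjes transform -/

variable {N : ℕ}

/-- The Gram matrix `G = 𝒪 K 𝒪ᵀ`, with entries `oᵢ (K oⱼ)`. -/
def gram (K : C(X × X, ℝ)) (o : Fin N → Observation X) : Matrix (Fin N) (Fin N) ℝ :=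
  Matrix.of fun i j => o i (kernelMap K (o j))

/-- `B(z) = (1/N) G - z I`. -/
def shiftedGram (K : C(X × X, ℝ)) (o : Fin N → Observation X) (z : ℂ) :
    Matrix (Fin N) (Fin N) ℂ :=
  (1 / N : ℂ) • (gram K o).map (fun x : ℝ => (x : ℂ)) - z • (1 : Matrix (Fin N) (Fin N) ℂ)

/-- The Stieltjes transform `m(z) = (1/N) Tr[B(z)⁻¹]`. -/
def stieltjes (K : C(X × X, ℝ)) (o : Fin N → Observation X) (z : ℂ) : ℂ :=
  1 / N * (shiftedGram K o z)⁻¹.trace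

/-- `g_k(z) = (1/N) (𝒪ₖ)ᵀ B₍ₖ₎(z)⁻¹ 𝒪ₖ`, where `𝒪ₖ = (oᵢ(f⁽ᵏ⁾))ᵢ` and `B₍ₖ₎(z)` is built from
the kernel `K₍ₖ₎ = K - dₖ f⁽ᵏ⁾ ⊗ f⁽ᵏ⁾`; the arguments are `c = dₖ` and `h = f⁽ᵏ⁾`. -/
def gFun (K : C(X × X, ℝ)) (c : ℝ) (h : C(X, ℝ)) (o : Fin N → Observation X) (z : ℂ) : ℂ :=
  1 / N * ((fun i => (o i h : ℂ)) ⬝ᵥ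
    (shiftedGram (K - c • tensor h h) o z)⁻¹.mulVec (fun i => (o i h : ℂ)))

/-- `𝔼 |F|^p ≤ b`, in the sense that the moment is finite and bounded by `b`. -/
def MomentLE {W : Type*} [MeasurableSpace W] (P : Measure W) (F : W → ℂ) (p : ℕ) (b : ℝ) : Prop :=
  Integrable (fun w => ‖F w‖ ^ p) P ∧ ∫ w, ‖F w‖ ^ p ∂P ≤ b

end Setting

end KRR

end

/-! The proof is a leave-one-out argument that compares an exact equation for $m_G$ with the
deterministic fixed point equation. Write $m=m_G(z)$ and let $w$ be the fixed point.

Expanding $\mathrm{Tr}[B(z)^{-1}\frac1N G]$ over the modes and applying Sherman–Morrison to each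
mode gives, for every realization, $m=-\frac1z\big(1-\frac1N\sum_k\frac{d_kg_k}{1+d_kg_k}\big)$
(`stieltjes_eq_tsum`). This is the fixed point equation with $g_k$ in place of the unknown, so two
estimates suffice.

Closeness of $g_k$ to $m$: the vector $\mathcal O_{\cdot k}$ is standard Gaussian and independent of
$G_{(k)}$, since uncorrelated jointly Gaussian variables are independent. Hence $g_k$ concentrates
around $m_{(k)}$, the Stieltjes transform of $G_{(k)}$, at scale $1/(|z|\sqrt N)$. A rank-one
perturbation moves the trace of the resolvent by at most $2/|z|$, so $|m-m_{(k)}|\le 2/(N|z|)$.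
Together these give `lintegral_stieltjes_sub_gFun_le`.

Stability: subtracting the two equations leaves $w-m$ multiplied by a factor whose real part is at
least 1, because $w$ and all the $g_k$ lie in the cone spanned by $1$ and $-1/z$. Hence
$|w-m|\le\frac1{|z|N}\sum_kd_k|m-g_k|$ (`norm_sub_le_of_isFixedPoint`). Jensen's inequality with
weights $d_k$ then yields the power $N^{-3s}$.

Stability also gives uniqueness of $w$. Existence comes from hyperbolic geometry: the equation reads
$w=1/u(w)$, and $w\mapsto1/u(w)$ strictly decreases hyperbolic distances in the right half-plane
while mapping the cone into a compact set. Finally, the $f^{(k)}$ diagonalize $T_K$, so the Signal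
Capture Threshold is $1/w$ at $z=-\lambda$. -/

namespace KRR

/-! ### The cone spanned by `1` and `-1/z` -/

/-- The cone `{a - b / z : a, b ≥ 0}`. -/
def cone (z : ℂ) : Set ℂ := {w | ∃ a b : ℝ, 0 ≤ a ∧ 0 ≤ b ∧ w = a - b * (1 / z)}

section Cone

variable {z : ℂ}

theorem zero_mem_cone : (0 : ℂ) ∈ cone z := ⟨0, 0, le_rfl, le_rfl, by simp⟩

theorem one_mem_cone : (1 : ℂ) ∈ cone z := ⟨1, 0, zero_le_one, le_rfl, by simp⟩

theorem neg_inv_mem_cone : -(1 / z) ∈ cone z := ⟨0, 1, le_rfl, zero_le_one, by simp⟩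

theorem add_mem_cone {u v : ℂ} (hu : u ∈ cone z) (hv : v ∈ cone z) : u + v ∈ cone z := by
  obtain ⟨a, b, ha, hb, rfl⟩ := hu
  obtain ⟨a', b', ha', hb', rfl⟩ := hv
  exact ⟨a + a', b + b', by positivity, by positivity, by push_cast; ring⟩

theorem mul_mem_cone {r : ℝ} (hr : 0 ≤ r) {u : ℂ} (hu : u ∈ cone z) : (r : ℂ) * u ∈ cone z := by
  obtain ⟨a, b, ha, hb, rfl⟩ := hu
  exact ⟨r * a, r * b, by positivity, by positivity, by push_cast; ring⟩

theorem sum_mem_cone {κ : Type*} (t : Finset κ) {u : κ → ℂ} (hu : ∀ k, u k ∈ cone z) :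
    ∑ k ∈ t, u k ∈ cone z := by
  classical
  induction t using Finset.induction_on with
  | empty => simpa using zero_mem_cone
  | insert k t hk ih => rw [Finset.sum_insert hk]; exact add_mem_cone (hu k) ih

theorem ne_zero_of_re_neg (hz : z.re < 0) : z ≠ 0 := by
  rintro rfl
  simp at hz

theorem re_one_div_neg (hz : z.re < 0) : (1 / z).re < 0 := by
  rw [one_div, Complex.inv_re]
  exact div_neg_of_neg_of_pos hz (Complex.normSq_pos.2 (ne_zero_of_re_neg hz))

theorem re_nonneg_of_mem_cone (hz : z.re < 0) {w : ℂ} (hw : w ∈ cone z) : 0 ≤ w.re := by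
  obtain ⟨a, b, ha, hb, rfl⟩ := hw
  have h := re_one_div_neg hz
  simp only [Complex.sub_re, Complex.ofReal_re, Complex.re_ofReal_mul]
  nlinarith

/-- Since $w^{-1}=\bar w/|w|^2$ and $\overline{1/z}=z/|z|^2$, conjugation turns a combination of $1$
and $-1/z$ into one of $1$ and $-z$. -/
theorem inv_mem_cone (hz : z ≠ 0) {w : ℂ} (hw : w ∈ cone z) : w⁻¹ ∈ cone z⁻¹ := by
  obtain ⟨a, b, ha, hb, rfl⟩ := hw
  set w : ℂ := a - b * (1 / z) with hw
  refine ⟨a / Complex.normSq w, b / Complex.normSq z / Complex.normSq w,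
    div_nonneg ha (Complex.normSq_nonneg _),
    div_nonneg (div_nonneg hb (Complex.normSq_nonneg _)) (Complex.normSq_nonneg _), ?_⟩
  rw [Complex.inv_def, hw, ← hw]
  have h : (starRingEnd ℂ) w = a - b * (z / Complex.normSq z) := by
    have : (starRingEnd ℂ) z ≠ 0 := by simpa using hz
    rw [hw, Complex.normSq_eq_conj_mul_self]
    simp only [map_sub, map_mul, map_div₀, Complex.conj_ofReal, map_one]
    field_simp
  rw [h]
  push_cast
  simp only [one_div, inv_inv]
  ring

/-- Both terms of $\Re w=a+b\,(-\Re(1/z))$ are nonnegative, so a bound on $w$ bounds $a$ and $b$.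
Locally the cone is thus contained in the image of a compact rectangle of coefficients. -/
theorem isClosed_cone (hz : z.re < 0) : IsClosed (cone z) := by
  have hre := re_one_div_neg hz
  rw [isClosed_iff_frequently]
  intro x hx
  set R := ‖x‖ + 1
  set S : Set ℂ := (fun p : ℝ × ℝ => (p.1 : ℂ) - p.2 * (1 / z)) ''
    (Set.Icc 0 R ×ˢ Set.Icc 0 (R / (-(1 / z).re)))
  have hS : IsCompact S :=
    (isCompact_Icc.prod isCompact_Icc).image (by fun_prop)
  have h : ∃ᶠ y in 𝓝 x, y ∈ S := by
    refine (hx.and_eventually (Metric.ball_mem_nhds x one_pos)).mono ?_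
    rintro _ ⟨⟨a, b, ha, hb, rfl⟩, hy⟩
    have h1 : ((a : ℂ) - b * (1 / z)).re ≤ R := by
      refine (Complex.re_le_norm _).trans ?_
      have := norm_le_norm_add_norm_sub' ((a : ℂ) - b * (1 / z)) x
      rw [dist_eq_norm] at hy
      exact this.trans (add_le_add le_rfl hy.le)
    simp only [Complex.sub_re, Complex.ofReal_re, Complex.re_ofReal_mul] at h1
    refine ⟨(a, b), ⟨⟨ha, by nlinarith⟩, hb, ?_⟩, rfl⟩
    rw [le_div_iff₀ (by linarith)]
    linarith
  obtain ⟨p, ⟨⟨h1, -⟩, ⟨h2, -⟩⟩, rfl⟩ := isClosed_iff_frequently.1 hS.isClosed x h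
  exact ⟨p.1, p.2, h1, h2, rfl⟩

theorem tsum_mem_cone (hz : z.re < 0) {κ : Type*} {u : κ → ℂ} (hu : ∀ k, u k ∈ cone z) :
    ∑' k, u k ∈ cone z := by
  by_cases h : Summable u
  · exact (isClosed_cone hz).mem_of_tendsto h.hasSum
      (Eventually.of_forall fun t => sum_mem_cone t hu)
  -- A divergent series has the default value 0, which lies in the cone.
  · rw [tsum_eq_zero_of_not_summable h]
    exact zero_mem_cone

theorem one_add_mul_mem_cone {r : ℝ} (hr : 0 ≤ r) {w : ℂ} (hw : w ∈ cone z) :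
    1 + (r : ℂ) * w ∈ cone z :=
  add_mem_cone one_mem_cone (mul_mem_cone hr hw)

theorem one_le_norm_one_add_mul {r : ℝ} (hr : 0 ≤ r) {w : ℂ} (hw : 0 ≤ w.re) :
    1 ≤ ‖1 + (r : ℂ) * w‖ := by
  refine le_trans ?_ (Complex.re_le_norm _)
  simp only [Complex.add_re, Complex.one_re, Complex.re_ofReal_mul]
  nlinarith

theorem one_add_mul_ne_zero {r : ℝ} (hr : 0 ≤ r) {w : ℂ} (hw : 0 ≤ w.re) :
    1 + (r : ℂ) * w ≠ 0 := by
  rw [← norm_pos_iff]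
  exact one_pos.trans_le (one_le_norm_one_add_mul hr hw)

/-- The argument of `-1/z` exceeds half of the argument of a product of two elements of the cone,
up to a right angle. -/
theorem re_neg_one_div_mul_inv_nonneg (hz : z.re < 0) {u v : ℂ} (hu : u ∈ cone z)
    (hv : v ∈ cone z) : 0 ≤ (-(1 / z) * (u * v)⁻¹).re := by
  obtain ⟨a, b, ha, hb, rfl⟩ := hu
  obtain ⟨a', b', ha', hb', rfl⟩ := hv
  have hre := re_one_div_neg hz
  generalize 1 / z = y at *
  rw [Complex.inv_def, ← mul_assoc, Complex.re_mul_ofReal]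
  refine mul_nonneg ?_ (inv_nonneg.2 (Complex.normSq_nonneg _))
  -- With $y=1/z$, the three terms of the expansion carry the factors $-\Re y$, $|y|^2$ and
  -- $-|y|^2\Re y$, all positive because $\Re y<0$.
  have : (-y * (starRingEnd ℂ) ((a - b * y) * (a' - b' * y))).re =
      a * a' * (-y.re) + (a * b' + a' * b) * (y.re ^ 2 + y.im ^ 2) +
        b * b' * (y.re ^ 2 + y.im ^ 2) * (-y.re) := by
    simp only [Complex.mul_re, Complex.mul_im, Complex.neg_re, Complex.neg_im, Complex.conj_re,
      Complex.conj_im, Complex.sub_re, Complex.sub_im, Complex.ofReal_re, Complex.ofReal_im]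
    ring
  rw [this]
  have : 0 < -y.re := by linarith
  positivity

end Cone

/-! ### The fixed point equation -/

section FixedPoint

variable {ι : Type*} {d : ι → ℝ} {z : ℂ} {N : ℕ}

theorem norm_div_one_add_mul_le {r : ℝ} (hr : 0 ≤ r) {w : ℂ} (hw : 0 ≤ w.re) (y : ℂ) :
    ‖(r : ℂ) * y / (1 + r * w)‖ ≤ r * ‖y‖ := by
  rw [norm_div, norm_mul, Complex.norm_real, Real.norm_of_nonneg hr]
  exact div_le_self (by positivity) (one_le_norm_one_add_mul hr hw)

/-- Stability of the fixed point equation. -/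
theorem norm_sub_le_of_isFixedPoint (hd : ∀ k, 0 ≤ d k) (hds : Summable d) (hz : z.re < 0)
    {w m : ℂ} {g : ι → ℂ} (hw : IsFixedPoint d N z w) (hg : ∀ k, g k ∈ cone z)
    (hgs : Summable fun k => d k * ‖g k‖)
    (hm : m = -(1 / z) * (1 - 1 / N * ∑' k, d k * g k / (1 + d k * g k))) :
    ‖w - m‖ ≤ 1 / (‖z‖ * N) * ∑' k, d k * ‖m - g k‖ := by
  have hwc : w ∈ cone z := hw.1
  have hwre := re_nonneg_of_mem_cone hz hwc
  have hgre := fun k => re_nonneg_of_mem_cone hz (hg k)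
  -- The divided difference of $t\mapsto d_kt/(1+d_kt)$ between $w$ and $g_k$.
  set e : ι → ℂ := fun k => d k * ((1 + d k * w) * (1 + d k * g k))⁻¹ with he
  have hen : ∀ k, ‖e k‖ ≤ d k := fun k => by
    rw [he, norm_mul, Complex.norm_real, Real.norm_of_nonneg (hd k), norm_inv, norm_mul]
    refine mul_le_of_le_one_right (hd k) (inv_le_one_of_one_le₀ ?_)
    nlinarith [one_le_norm_one_add_mul (hd k) hwre, one_le_norm_one_add_mul (hd k) (hgre k)]
  have hes : Summable e := .of_norm_bounded hds hen
  have hmgs : Summable fun k => d k * ‖m - g k‖ := by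
    refine .of_nonneg_of_le (fun k => mul_nonneg (hd k) (norm_nonneg _)) (fun k => ?_)
      ((hds.mul_right ‖m‖).add hgs)
    rw [← mul_add]
    exact mul_le_mul_of_nonneg_left (norm_sub_le _ _) (hd k)
  have hemn : ∀ k, ‖e k * (m - g k)‖ ≤ d k * ‖m - g k‖ := fun k => by
    rw [norm_mul]
    exact mul_le_mul_of_nonneg_right (hen k) (norm_nonneg _)
  have hems : Summable fun k => e k * (m - g k) := .of_norm_bounded hmgs hemn
  have hs1 : Summable fun k => (d k : ℂ) * w / (1 + d k * w) :=
    .of_norm_bounded (hds.mul_right ‖w‖) fun k => norm_div_one_add_mul_le (hd k) hwre w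
  have hs2 : Summable fun k => (d k : ℂ) * g k / (1 + d k * g k) :=
    .of_norm_bounded hgs fun k => norm_div_one_add_mul_le (hd k) (hgre k) (g k)
  -- Split $w-g_k=(w-m)+(m-g_k)$: the first part is absorbed into the left-hand side, the second is
  -- the error.
  have hdiff : ∑' k, (d k : ℂ) * w / (1 + d k * w) - ∑' k, (d k : ℂ) * g k / (1 + d k * g k) =
      (∑' k, e k) * (w - m) + ∑' k, e k * (m - g k) := by
    rw [← hs1.tsum_sub hs2, ← tsum_mul_right, ← (hes.mul_right _).tsum_add hems]
    refine tsum_congr fun k => ?_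
    have h1 := one_add_mul_ne_zero (hd k) hwre
    have h2 := one_add_mul_ne_zero (hd k) (hgre k)
    simp only [he]
    field_simp
    ring
  have heq : (w - m) * (1 + -(1 / z) * (1 / N) * ∑' k, e k) =
      1 / z * (1 / N) * ∑' k, e k * (m - g k) := by
    have : w - m = 1 / z * (1 / N) * (∑' k, (d k : ℂ) * w / (1 + d k * w) -
        ∑' k, (d k : ℂ) * g k / (1 + d k * g k)) := by
      conv_lhs => rw [hw.2, hm]
      ring
    rw [hdiff] at this
    linear_combination this
  -- Each $-\frac1z e_k$ has nonnegative real part, so the factor in front of $w-m$ cannot shrink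
  -- it.
  have hre : 1 ≤ ‖1 + -(1 / z) * (1 / N) * ∑' k, e k‖ := by
    refine le_trans ?_ (Complex.re_le_norm _)
    have h : (-(1 / z) * (1 / N) * ∑' k, e k) =
        ((1 / N : ℝ) : ℂ) * ∑' k, (d k : ℂ) * (-(1 / z) * ((1 + d k * w) * (1 + d k * g k))⁻¹) := by
      push_cast
      rw [mul_comm (-(1 / z)), mul_assoc, ← tsum_mul_left]
      congr 1
      refine tsum_congr fun k => ?_
      simp only [he]
      ring
    have h2 : ∀ k, (d k : ℂ) * (-(1 / z) * ((1 + d k * w) * (1 + d k * g k))⁻¹) =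
        -(1 / z) * e k := fun k => by simp only [he]; ring
    rw [h, Complex.add_re, Complex.one_re, Complex.re_ofReal_mul, Complex.re_tsum]
    · have : 0 ≤ ∑' k, ((d k : ℂ) * (-(1 / z) * ((1 + d k * w) * (1 + d k * g k))⁻¹)).re :=
        tsum_nonneg fun k => by
          rw [Complex.re_ofReal_mul]
          exact mul_nonneg (hd k) (re_neg_one_div_mul_inv_nonneg hz
            (one_add_mul_mem_cone (hd k) hwc) (one_add_mul_mem_cone (hd k) (hg k)))
      have h3 : (0 : ℝ) ≤ 1 / N := by positivity
      nlinarith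
    · simp only [h2]
      exact hes.mul_left _
  calc ‖w - m‖ ≤ ‖w - m‖ * ‖1 + -(1 / z) * (1 / N) * ∑' k, e k‖ :=
        le_mul_of_one_le_right (norm_nonneg _) hre
    _ = 1 / (‖z‖ * N) * ‖∑' k, e k * (m - g k)‖ := by
        rw [← norm_mul, heq, norm_mul, norm_mul, norm_div, norm_div]
        simp [mul_comm]
    _ ≤ 1 / (‖z‖ * N) * ∑' k, d k * ‖m - g k‖ := by
        gcongr
        exact tsum_of_norm_bounded hmgs.hasSum hemn

/-- Stability with every $g_k$ and $m$ equal to the second solution: the error term vanishes. -/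
theorem IsFixedPoint.unique (hd : ∀ k, 0 ≤ d k) (hds : Summable d) (hz : z.re < 0) {w w' : ℂ}
    (hw : IsFixedPoint d N z w) (hw' : IsFixedPoint d N z w') : w' = w := by
  have := norm_sub_le_of_isFixedPoint hd hds hz hw (g := fun _ => w') (fun _ => hw'.1)
    (hds.mul_right _) hw'.2
  simp only [sub_self, norm_zero, mul_zero, tsum_zero] at this
  exact (sub_eq_zero.1 (norm_le_zero_iff.1 this)).symm

theorem tsum_sq_le_tsum_mul_tsum {α β c : ι → ℝ} (hα : ∀ k, 0 ≤ α k) (hβ : ∀ k, 0 ≤ β k)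
    (hc : ∀ k, c k ^ 2 ≤ α k * β k) (hαs : Summable α) (hβs : Summable β) (hcs : Summable c) :
    (∑' k, c k) ^ 2 ≤ (∑' k, α k) * ∑' k, β k :=
  le_of_tendsto_of_tendsto' (hcs.hasSum.pow 2) (Tendsto.mul hαs.hasSum hβs.hasSum) fun t =>
    Finset.sum_sq_le_sum_mul_sum_of_sq_le_mul t (fun k _ => hα k) (fun k _ => hβ k)
      fun k _ => hc k

theorem norm_div_one_add_le {r : ℝ} (hr : 0 ≤ r) {w : ℂ} (hw : 0 ≤ w.re) :
    ‖(r : ℂ) / (1 + r * w)‖ ≤ r := by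
  simpa using norm_div_one_add_mul_le hr hw 1

theorem summable_div_one_add (hd : ∀ k, 0 ≤ d k) (hds : Summable d) {w : ℂ} (hw : 0 ≤ w.re) :
    Summable fun k => (d k : ℂ) / (1 + d k * w) :=
  .of_norm_bounded hds fun k => norm_div_one_add_le (hd k) hw

theorem re_div_one_add {r : ℝ} {w : ℂ} : ((r : ℂ) / (1 + r * w)).re =
    r * (1 + r * w.re) / ‖1 + (r : ℂ) * w‖ ^ 2 := by
  rw [div_eq_mul_inv, Complex.re_ofReal_mul, Complex.inv_re, Complex.normSq_eq_norm_sq]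
  simp [mul_div_assoc]

/-- `w ↦ ∑ₖ dₖ / (1 + dₖ w)` does not increase the hyperbolic distance of the right half-plane. -/
theorem norm_tsum_sub_sq_mul_le (hd : ∀ k, 0 ≤ d k) (hds : Summable d) {w₁ w₂ : ℂ}
    (h₁ : 0 < w₁.re) (h₂ : 0 < w₂.re) :
    ‖∑' k, (d k : ℂ) / (1 + d k * w₁) - ∑' k, (d k : ℂ) / (1 + d k * w₂)‖ ^ 2 *
        (w₁.re * w₂.re) ≤
      ‖w₁ - w₂‖ ^ 2 *
        ((∑' k, (d k : ℂ) / (1 + d k * w₁)).re * (∑' k, (d k : ℂ) / (1 + d k * w₂)).re) := by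
  have hs₁ := summable_div_one_add hd hds h₁.le
  have hs₂ := summable_div_one_add hd hds h₂.le
  have hpos : 0 < w₁.re * w₂.re := mul_pos h₁ h₂
  rw [← hs₁.tsum_sub hs₂, Complex.re_tsum hs₁, Complex.re_tsum hs₂]
  have hsum : Summable fun k => ‖(d k : ℂ) / (1 + d k * w₁) - (d k : ℂ) / (1 + d k * w₂)‖ :=
    .of_nonneg_of_le (fun _ => norm_nonneg _) (fun k => (norm_sub_le _ _).trans
      (add_le_add (norm_div_one_add_le (hd k) h₁.le) (norm_div_one_add_le (hd k) h₂.le)))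
      (hds.add hds)
  have hre : ∀ {w : ℂ}, 0 < w.re → ∀ k, 0 ≤ ((d k : ℂ) / (1 + d k * w)).re := fun hw k => by
    rw [re_div_one_add]
    have := hd k
    positivity
  -- The ratio $|w_1-w_2|^2/(\Re w_1\Re w_2)$ is an increasing function of hyperbolic distance. Each
  -- summand does not increase it, and Cauchy–Schwarz passes this to the sum.
  have key := tsum_sq_le_tsum_mul_tsum
    (α := fun k => ‖w₁ - w₂‖ ^ 2 * ((d k : ℂ) / (1 + d k * w₁)).re / w₁.re)
    (β := fun k => ((d k : ℂ) / (1 + d k * w₂)).re / w₂.re)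
    (c := fun k => ‖(d k : ℂ) / (1 + d k * w₁) - (d k : ℂ) / (1 + d k * w₂)‖)
    (fun k => by have := hre h₁ k; positivity) (fun k => by have := hre h₂ k; positivity)
    (fun k => ?_) (((Complex.hasSum_re hs₁.hasSum).summable.mul_left _).div_const _)
    ((Complex.hasSum_re hs₂.hasSum).summable.div_const _) hsum
  · rw [tsum_div_const, tsum_div_const, tsum_mul_left, div_mul_div_comm,
      le_div_iff₀ hpos] at key
    refine le_trans (mul_le_mul_of_nonneg_right ?_ hpos.le) (key.trans_eq (by ring))
    exact pow_le_pow_left₀ (norm_nonneg _) (norm_tsum_le_tsum_norm hsum) 2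
  · have hd' := hd k
    have n1 := one_add_mul_ne_zero hd' h₁.le
    have n2 := one_add_mul_ne_zero hd' h₂.le
    have hsub : (d k : ℂ) / (1 + d k * w₁) - (d k : ℂ) / (1 + d k * w₂) =
        -(d k) ^ 2 * (w₁ - w₂) / ((1 + d k * w₁) * (1 + d k * w₂)) := by
      field_simp
      ring
    have p1 := norm_pos_iff.2 n1
    have p2 := norm_pos_iff.2 n2
    rw [hsub, re_div_one_add, re_div_one_add, norm_div, norm_mul, norm_mul, norm_neg, norm_pow,
      Complex.norm_real, Real.norm_of_nonneg hd']
    have e1 : ‖w₁ - w₂‖ ^ 2 * (d k * (1 + d k * w₁.re) / ‖1 + (d k : ℂ) * w₁‖ ^ 2) / w₁.re *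
        (d k * (1 + d k * w₂.re) / ‖1 + (d k : ℂ) * w₂‖ ^ 2 / w₂.re) =
        ‖w₁ - w₂‖ ^ 2 * (d k * (1 + d k * w₁.re) * (d k * (1 + d k * w₂.re))) /
          (‖1 + (d k : ℂ) * w₁‖ ^ 2 * ‖1 + (d k : ℂ) * w₂‖ ^ 2 * (w₁.re * w₂.re)) := by
      field_simp
    rw [e1, div_pow, mul_pow, mul_pow, div_le_div_iff₀ (by positivity) (by positivity)]
    have h3 : d k ^ 2 * d k ^ 2 * (w₁.re * w₂.re) ≤
        d k * (1 + d k * w₁.re) * (d k * (1 + d k * w₂.re)) := by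
      have e : d k * (1 + d k * w₁.re) * (d k * (1 + d k * w₂.re)) =
        d k ^ 2 * d k ^ 2 * (w₁.re * w₂.re) + d k ^ 2 * (1 + d k * w₁.re + d k * w₂.re) := by ring
      rw [e]
      have : 0 ≤ d k ^ 2 * (1 + d k * w₁.re + d k * w₂.re) := by positivity
      linarith
    have h4 : 0 ≤ ‖w₁ - w₂‖ ^ 2 * (‖1 + (d k : ℂ) * w₁‖ ^ 2 * ‖1 + (d k : ℂ) * w₂‖ ^ 2) := by
      positivity
    nlinarith [mul_le_mul_of_nonneg_left h3 h4]

/-- Inversion preserves the hyperbolic distance of the right half-plane. -/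
theorem norm_inv_sub_inv_sq_div {u v : ℂ} (hu : u ≠ 0) (hv : v ≠ 0) :
    ‖u⁻¹ - v⁻¹‖ ^ 2 / ((u⁻¹).re * (v⁻¹).re) = ‖u - v‖ ^ 2 / (u.re * v.re) := by
  have : u⁻¹ - v⁻¹ = (v - u) / (u * v) := by field_simp
  rw [this, Complex.inv_re, Complex.inv_re, Complex.normSq_eq_norm_sq,
    Complex.normSq_eq_norm_sq, norm_div, norm_mul, norm_sub_rev]
  have := norm_pos_iff.2 hu
  have := norm_pos_iff.2 hv
  field_simp

/-- The equation is $w=1/u(w)$ with $u(w)=-z+\frac1N\sum_k d_k/(1+d_kw)$. The sum does not increase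
hyperbolic distances, inversion preserves them, and adding $-z$ strictly decreases them because it
enlarges real parts. A point of minimal displacement on a compact set mapped into itself must
therefore be fixed. -/
theorem exists_isFixedPoint (hd : ∀ k, 0 ≤ d k) (hds : Summable d) (hz : z.re < 0) (hN : 0 < N) :
    ∃ w, IsFixedPoint d N z w := by
  have hz0 := ne_zero_of_re_neg hz
  have hzn : 0 < ‖z‖ := norm_pos_iff.2 hz0
  have hNr : (0 : ℝ) < N := by exact_mod_cast hN
  set S : ℂ → ℂ := fun w => ∑' k, (d k : ℂ) / (1 + d k * w) with hS
  set u : ℂ → ℂ := fun w => -z + ((1 / N : ℝ) : ℂ) * S w with hu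
  have hz' : (z⁻¹).re < 0 := by simpa using re_one_div_neg hz
  have hSc : ∀ w ∈ cone z, S w ∈ cone z⁻¹ := fun w hw => tsum_mem_cone hz' fun k => by
    rw [div_eq_mul_inv]
    exact mul_mem_cone (hd k) (inv_mem_cone hz0 (one_add_mul_mem_cone (hd k) hw))
  have hSre : ∀ w ∈ cone z, 0 ≤ (S w).re := fun w hw => re_nonneg_of_mem_cone hz' (hSc w hw)
  have hure' : ∀ w, (u w).re = -z.re + 1 / N * (S w).re := fun w => by
    simp only [hu, Complex.add_re, Complex.neg_re, Complex.re_ofReal_mul]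
  have hure : ∀ w ∈ cone z, -z.re ≤ (u w).re := fun w hw => by
    rw [hure']
    have := hSre w hw
    have : 0 ≤ 1 / (N : ℝ) * (S w).re := by positivity
    linarith
  have huc : ∀ w ∈ cone z, (u w)⁻¹ ∈ cone z := fun w hw => by
    rw [← inv_inv z]
    refine inv_mem_cone (inv_ne_zero hz0) (add_mem_cone ?_ (mul_mem_cone (by positivity) (hSc w hw)))
    simpa using neg_inv_mem_cone (z := z⁻¹)
  -- Here $u(w)=p-(1+q)z$ with $p,q\ge0$, and $\Re z<0$ rules out cancellation.
  have hun : ∀ w ∈ cone z, ‖z‖ ≤ ‖u w‖ := fun w hw => by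
    obtain ⟨p, q, hp, hq, h⟩ := mul_mem_cone (r := 1 / N) (by positivity) (hSc w hw)
    simp only [one_div, inv_inv] at h
    have : u w = p - (1 + q) * z := by simp only [hu]; rw [one_div, h]; ring
    rw [← abs_norm z, ← abs_norm (u w), ← sq_le_sq, this, ← Complex.normSq_eq_norm_sq,
      ← Complex.normSq_eq_norm_sq, Complex.normSq_apply, Complex.normSq_apply]
    simp
    nlinarith [mul_nonneg hq (sq_nonneg z.re), mul_nonneg hq (sq_nonneg z.im),
      mul_nonneg (mul_nonneg hq hq) (sq_nonneg z.re), mul_nonneg (mul_nonneg hq hq) (sq_nonneg z.im),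
      mul_nonneg (mul_nonneg hp (add_nonneg zero_le_one hq)) (neg_nonneg.2 hz.le), sq_nonneg p]
  set B := ‖z‖ + 1 / N * ∑' k, d k with hB
  have hds0 : 0 ≤ ∑' k, d k := tsum_nonneg hd
  have hBpos : 0 < B := by positivity
  have huB : ∀ w ∈ cone z, ‖u w‖ ≤ B := fun w hw => by
    refine (norm_add_le _ _).trans ?_
    rw [norm_neg, norm_mul, Complex.norm_real, Real.norm_of_nonneg (by positivity)]
    refine add_le_add le_rfl (mul_le_mul_of_nonneg_left ?_ (by positivity))
    exact tsum_of_norm_bounded hds.hasSum fun k =>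
      norm_div_one_add_le (hd k) (re_nonneg_of_mem_cone hz hw)
  -- This is a lower bound for $\Re(1/u)=\Re u/|u|^2$. It keeps the compact set away from the
  -- imaginary axis, where the hyperbolic metric degenerates.
  set ε := -z.re / B ^ 2 with hε
  have hεpos : 0 < ε := div_pos (by linarith) (by positivity)
  set C : Set ℂ := (cone z ∩ Metric.closedBall 0 (1 / ‖z‖)) ∩ {w | ε ≤ w.re} with hC
  have hCc : IsCompact C :=
    Metric.isCompact_of_isClosed_isBounded
      (((isClosed_cone hz).inter Metric.isClosed_closedBall).inter
        (isClosed_le continuous_const Complex.continuous_re))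
      (Metric.isBounded_closedBall.subset fun w hw => hw.1.2)
  have hmaps : ∀ w ∈ cone z, (u w)⁻¹ ∈ C := fun w hw => by
    refine ⟨⟨huc w hw, ?_⟩, ?_⟩
    · rw [mem_closedBall_zero_iff, norm_inv, one_div]
      exact inv_anti₀ hzn (hun w hw)
    · rw [Set.mem_ofPred_eq, Complex.inv_re, Complex.normSq_eq_norm_sq]
      have h1 := hure w hw
      have h2 := hun w hw
      have h3 := huB w hw
      refine div_le_div₀ (by linarith) h1 (pow_pos (hzn.trans_le h2) 2) ?_
      gcongr
  have hcont : ContinuousOn (fun w => (u w)⁻¹) C := by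
    refine ContinuousOn.inv₀ ?_ fun w hw => norm_pos_iff.1 (hzn.trans_le (hun w hw.1.1))
    refine continuousOn_const.add (continuousOn_const.mul ?_)
    refine continuousOn_tsum (fun k => ?_) hds fun k w hw =>
      norm_div_one_add_le (hd k) (re_nonneg_of_mem_cone hz hw.1.1)
    exact continuousOn_const.div (by fun_prop) fun w hw =>
      one_add_mul_ne_zero (hd k) (re_nonneg_of_mem_cone hz hw.1.1)
  have hpos : ∀ w ∈ C, 0 < w.re := fun w hw => hεpos.trans_le hw.2
  obtain ⟨w, hwC, hmin⟩ := hCc.exists_isMinOn ⟨_, hmaps 1 one_mem_cone⟩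
    (f := fun w => ‖w - (u w)⁻¹‖ ^ 2 / (w.re * ((u w)⁻¹).re))
    (((continuousOn_id.sub hcont).norm.pow 2).div
      (Complex.continuous_re.continuousOn.mul (Complex.continuous_re.comp_continuousOn hcont))
      fun w hw => (mul_pos (hpos w hw) (hpos _ (hmaps w hw.1.1))).ne')
  have hfix : w = (u w)⁻¹ := by
    by_contra hne
    set v := (u w)⁻¹ with hv
    have hvC : v ∈ C := hmaps w hwC.1.1
    have h1 := hmin hvC
    simp only [Set.mem_ofPred_eq] at h1
    rw [← hv] at h1
    refine absurd h1 (not_le.2 ?_)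
    have hw0 := hpos w hwC
    have hv0 := hpos v hvC
    have huw : u w ≠ 0 := norm_pos_iff.1 (hzn.trans_le (hun w hwC.1.1))
    have huv : u v ≠ 0 := norm_pos_iff.1 (hzn.trans_le (hun v hvC.1.1))
    have huwre := (neg_pos.2 hz).trans_le (hure w hwC.1.1)
    have huvre := (neg_pos.2 hz).trans_le (hure v hvC.1.1)
    have e1 : ‖v - (u v)⁻¹‖ ^ 2 / (v.re * ((u v)⁻¹).re) =
        ‖u w - u v‖ ^ 2 / ((u w).re * (u v).re) := by
      have := norm_inv_sub_inv_sq_div huw huv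
      rwa [← hv] at this
    rw [e1, div_lt_div_iff₀ (by positivity) (by positivity)]
    have h2 := norm_tsum_sub_sq_mul_le hd hds hw0 hv0
    have e2 : ‖u w - u v‖ ^ 2 = (1 / N) ^ 2 * ‖S w - S v‖ ^ 2 := by
      have : u w - u v = ((1 / N : ℝ) : ℂ) * (S w - S v) := by simp only [hu]; ring
      rw [this, norm_mul, Complex.norm_real, Real.norm_of_nonneg (by positivity), mul_pow]
    -- The strict inequality comes from the summand $-\Re z>0$ in $\Re u$.
    have h3 : (1 / N * (S w).re) * (1 / N * (S v).re) < (u w).re * (u v).re := by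
      have hw' := hSre w hwC.1.1
      have hv' := hSre v hvC.1.1
      refine mul_lt_mul'' ?_ ?_ (by positivity) (by positivity)
      · rw [hure']; linarith
      · rw [hure']; linarith
    have h4 : 0 < ‖w - v‖ ^ 2 := by
      have := norm_pos_iff.2 (sub_ne_zero.2 hne)
      positivity
    rw [e2, mul_assoc]
    calc (1 / (N : ℝ)) ^ 2 * (‖S w - S v‖ ^ 2 * (w.re * v.re))
        ≤ (1 / (N : ℝ)) ^ 2 * (‖w - v‖ ^ 2 * ((S w).re * (S v).re)) := by gcongr
      _ = ‖w - v‖ ^ 2 * ((1 / N * (S w).re) * (1 / N * (S v).re)) := by ring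
      _ < ‖w - v‖ ^ 2 * ((u w).re * (u v).re) := by gcongr
  refine ⟨w, hwC.1.1, ?_⟩
  have huw : u w ≠ 0 := norm_pos_iff.1 (hzn.trans_le (hun w hwC.1.1))
  have h1 : w * u w = 1 := by
    exact (congrArg (· * u w) hfix).trans (inv_mul_cancel₀ huw)
  have h2 : ∑' k, (d k : ℂ) * w / (1 + d k * w) = w * S w := by
    rw [hS, ← tsum_mul_left]
    exact tsum_congr fun k => by ring
  rw [h2]
  simp only [hu] at h1
  push_cast at h1
  field_simp
  field_simp at h1
  linear_combination -h1

theorem existsUnique_isFixedPoint (hd : ∀ k, 0 ≤ d k) (hds : Summable d) (hz : z.re < 0)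
    (hN : 0 < N) : ∃! w, IsFixedPoint d N z w := by
  obtain ⟨w, hw⟩ := exists_isFixedPoint hd hds hz hN
  exact ⟨w, hw, fun w' hw' => hw.unique hd hds hz hw'⟩

end FixedPoint

/-! ### Resolvents of real positive semidefinite matrices -/

section Resolvent

open Matrix

variable {N : ℕ}

/-- The complex vector with real entries `x i`. -/
def toC (x : Fin N → ℝ) : Fin N → ℂ := fun i => (x i : ℂ)

/-- The resolvent `(M - z I)⁻¹` of a real matrix. -/
noncomputable def resolvent (M : Matrix (Fin N) (Fin N) ℝ) (z : ℂ) : Matrix (Fin N) (Fin N) ℂ :=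
  (M.map (fun x : ℝ => (x : ℂ)) - z • (1 : Matrix (Fin N) (Fin N) ℂ))⁻¹

/-- The complex quadratic form `xᵀ A x` of a real vector `x`. -/
noncomputable def quad (A : Matrix (Fin N) (Fin N) ℂ) (x : Fin N → ℝ) : ℂ :=
  toC x ⬝ᵥ A *ᵥ toC x

theorem measurable_det {Ω : Type*} [MeasurableSpace Ω] {A : Ω → Matrix (Fin N) (Fin N) ℂ}
    (hA : ∀ i j, Measurable fun ω => A ω i j) : Measurable fun ω => (A ω).det := by
  simp only [det_apply']
  exact Finset.measurable_sum _ fun σ _ =>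
    (Finset.measurable_prod _ fun i _ => hA _ _).const_mul _

/-- By Cramer's rule the entries are determinants times the inverse of a determinant. Singular
matrices need no separate treatment, as inversion in ℂ is total and measurable. -/
theorem measurable_inv_apply {Ω : Type*} [MeasurableSpace Ω] {A : Ω → Matrix (Fin N) (Fin N) ℂ}
    (hA : ∀ i j, Measurable fun ω => A ω i j) (i j : Fin N) :
    Measurable fun ω => (A ω)⁻¹ i j := by
  simp only [inv_def, Ring.inverse_eq_inv', Matrix.smul_apply, adjugate_apply, smul_eq_mul]
  refine (measurable_det hA).inv.mul (measurable_det fun k l => ?_)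
  by_cases h : k = j
  · simp [updateRow_apply, h]
  · simpa [updateRow_apply, h] using hA k l

theorem measurable_resolvent_apply {Ω : Type*} [MeasurableSpace Ω]
    {M : Ω → Matrix (Fin N) (Fin N) ℝ} (hM : ∀ i j, Measurable fun ω => M ω i j) (z : ℂ)
    (i j : Fin N) : Measurable fun ω => resolvent (M ω) z i j := by
  refine measurable_inv_apply (fun i j => ?_) i j
  simp only [Matrix.sub_apply, map_apply]
  exact (Complex.measurable_ofReal.comp (hM i j)).sub_const _

theorem measurable_trace_resolvent {Ω : Type*} [MeasurableSpace Ω]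
    {M : Ω → Matrix (Fin N) (Fin N) ℝ} (hM : ∀ i j, Measurable fun ω => M ω i j) (z : ℂ) :
    Measurable fun ω => (resolvent (M ω) z).trace :=
  Finset.measurable_sum _ fun i _ => measurable_resolvent_apply hM z i i

theorem measurable_quad_resolvent {Ω : Type*} [MeasurableSpace Ω]
    {M : Ω → Matrix (Fin N) (Fin N) ℝ} {x : Ω → Fin N → ℝ}
    (hM : ∀ i j, Measurable fun ω => M ω i j) (hx : ∀ i, Measurable fun ω => x ω i) (z : ℂ) :
    Measurable fun ω => quad (resolvent (M ω) z) (x ω) := by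
  simp only [quad, dotProduct, mulVec, toC]
  refine Finset.measurable_sum _ fun i _ => (Complex.measurable_ofReal.comp (hx i)).mul ?_
  exact Finset.measurable_sum _ fun j _ =>
    (measurable_resolvent_apply hM z i j).mul (Complex.measurable_ofReal.comp (hx j))

/-- An orthogonal diagonalization `M = U diag(l) Uᵀ`. -/
structure IsOrthDiag (M U : Matrix (Fin N) (Fin N) ℝ) (l : Fin N → ℝ) : Prop where
  nonneg : ∀ i, 0 ≤ l i
  left_inv : Uᵀ * U = 1
  right_inv : U * Uᵀ = 1
  eq : M = U * diagonal l * Uᵀ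

/-- The standard Gaussian measure on `ℝ^N`. -/
noncomputable abbrev stdNormal (N : ℕ) : Measure (Fin N → ℝ) :=
  Measure.pi fun _ : Fin N => gaussianReal 0 1

/-- The spectral theorem, together with the rotation invariance of the standard Gaussian measure. -/
theorem exists_isOrthDiag {M : Matrix (Fin N) (Fin N) ℝ} (hM : M.PosSemidef) :
    ∃ U l, IsOrthDiag M U l ∧
      MeasurePreserving (fun x : Fin N → ℝ => U *ᵥ x) (stdNormal N) (stdNormal N) := by
  set hH := hM.isHermitian
  set U : Matrix (Fin N) (Fin N) ℝ := (hH.eigenvectorUnitary).1 with hU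
  have hst : star U = Uᵀ := by rw [star_eq_conjTranspose, conjTranspose_eq_transpose_of_trivial]
  refine ⟨U, hH.eigenvalues, ⟨hM.eigenvalues_nonneg, ?_, ?_, ?_⟩, by fun_prop, ?_⟩
  · rw [← hst]
    exact Unitary.coe_star_mul_self hH.eigenvectorUnitary
  · rw [← hst]
    exact Unitary.coe_mul_star_self hH.eigenvectorUnitary
  · rw [← hst]
    conv_lhs => rw [hH.spectral_theorem]
    rw [Unitary.conjStarAlgAut_apply]
    rfl
  · have h1 := stdGaussian_eq_map_pi_orthonormalBasis hH.eigenvectorBasis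
    rw [← map_pi_eq_stdGaussian] at h1
    have h2 := congrArg (Measure.map (fun v : EuclideanSpace ℝ (Fin N) => v.ofLp)) h1
    rw [Measure.map_map (by fun_prop) (by fun_prop),
      Measure.map_map (by fun_prop) (by fun_prop)] at h2
    have h3 : (fun v : EuclideanSpace ℝ (Fin N) => v.ofLp) ∘ (WithLp.toLp 2) = id := rfl
    rw [h3, Measure.map_id] at h2
    conv_rhs => rw [stdNormal, h2]
    congr 1
    ext x i
    simp [hU, mulVec, dotProduct, mul_comm]

namespace IsOrthDiag

variable {M U : Matrix (Fin N) (Fin N) ℝ} {l : Fin N → ℝ} {z : ℂ}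

theorem sub_ne_zero (h : IsOrthDiag M U l) (hz : z.re < 0) (i : Fin N) : (l i : ℂ) - z ≠ 0 := by
  intro h0
  have := congrArg Complex.re h0
  simp only [Complex.sub_re, Complex.ofReal_re, Complex.zero_re] at this
  linarith [h.nonneg i]

theorem mul_resolvent_form (h : IsOrthDiag M U l) (hz : z.re < 0) :
    (M.map (fun x : ℝ => (x : ℂ)) - z • (1 : Matrix (Fin N) (Fin N) ℂ)) *
      (U.map Complex.ofRealHom * diagonal (fun i => ((l i : ℂ) - z)⁻¹) *
        (U.map Complex.ofRealHom)ᵀ) = 1 := by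
  set V := U.map Complex.ofRealHom with hV
  have h1 : Vᵀ * V = 1 := by
    rw [hV, ← transpose_map, ← Matrix.map_mul, h.left_inv, Matrix.map_one _ (map_zero _) (map_one _)]
  have h2 : V * Vᵀ = 1 := by
    rw [hV, ← transpose_map, ← Matrix.map_mul, h.right_inv,
      Matrix.map_one _ (map_zero _) (map_one _)]
  have h3 : M.map (fun x : ℝ => (x : ℂ)) = V * diagonal (fun i => (l i : ℂ)) * Vᵀ := by
    have : M.map (fun x : ℝ => (x : ℂ)) = M.map Complex.ofRealHom := rfl
    rw [this, h.eq, Matrix.map_mul, Matrix.map_mul, transpose_map,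
      Matrix.diagonal_map (map_zero _)]
    rfl
  have h4 : z • (1 : Matrix (Fin N) (Fin N) ℂ) = V * diagonal (fun _ => z) * Vᵀ := by
    have : diagonal (fun _ : Fin N => z) = z • (1 : Matrix (Fin N) (Fin N) ℂ) := by
      rw [smul_one_eq_diagonal]
    rw [this, Matrix.mul_smul, Matrix.smul_mul, Matrix.mul_one, h2]
  rw [h3, h4, ← sub_mul, ← mul_sub, diagonal_sub]
  calc V * diagonal (fun i => (l i : ℂ) - z) * Vᵀ * (V * diagonal (fun i => ((l i : ℂ) - z)⁻¹) * Vᵀ)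
      = V * (diagonal (fun i => (l i : ℂ) - z) * (Vᵀ * V) *
          diagonal (fun i => ((l i : ℂ) - z)⁻¹)) * Vᵀ := by simp only [mul_assoc]
    _ = 1 := by
      rw [h1, mul_one, diagonal_mul_diagonal]
      simp only [mul_inv_cancel₀ (h.sub_ne_zero hz _), diagonal_one, mul_one, h2]

theorem resolvent_eq (h : IsOrthDiag M U l) (hz : z.re < 0) :
    resolvent M z = U.map Complex.ofRealHom * diagonal (fun i => ((l i : ℂ) - z)⁻¹) *
        (U.map Complex.ofRealHom)ᵀ :=
  inv_eq_right_inv (h.mul_resolvent_form hz)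

theorem trace_conj (h : IsOrthDiag M U l) (c : Fin N → ℂ) :
    (U.map Complex.ofRealHom * diagonal c * (U.map Complex.ofRealHom)ᵀ).trace = ∑ i, c i := by
  rw [trace_mul_comm, ← mul_assoc, ← transpose_map, ← Matrix.map_mul, h.left_inv,
    Matrix.map_one _ (map_zero _) (map_one _), one_mul, trace_diagonal]

theorem quad_conj (U : Matrix (Fin N) (Fin N) ℝ) (c : Fin N → ℂ) (x : Fin N → ℝ) :
    quad (U.map Complex.ofRealHom * diagonal c * (U.map Complex.ofRealHom)ᵀ) x =
      ∑ i, c i * (((Uᵀ *ᵥ x) i : ℝ) : ℂ) ^ 2 := by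
  have h : (U.map Complex.ofRealHom)ᵀ *ᵥ toC x = toC (Uᵀ *ᵥ x) := by
    ext i
    simp [toC, mulVec, dotProduct]
  rw [quad, ← mulVec_mulVec, ← mulVec_mulVec, dotProduct_mulVec, ← mulVec_transpose, h,
    dotProduct]
  refine Finset.sum_congr rfl fun i _ => ?_
  rw [mulVec_diagonal, toC]
  ring

theorem trace_resolvent (h : IsOrthDiag M U l) (hz : z.re < 0) :
    (resolvent M z).trace = ∑ i, ((l i : ℂ) - z)⁻¹ := by
  rw [h.resolvent_eq hz, h.trace_conj]

theorem quad_resolvent (h : IsOrthDiag M U l) (hz : z.re < 0) (x : Fin N → ℝ) :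
    quad (resolvent M z) x = ∑ i, ((l i : ℂ) - z)⁻¹ * (((Uᵀ *ᵥ x) i : ℝ) : ℂ) ^ 2 := by
  rw [h.resolvent_eq hz, quad_conj]

theorem quad_resolvent_sq (h : IsOrthDiag M U l) (hz : z.re < 0) (x : Fin N → ℝ) :
    quad (resolvent M z * resolvent M z) x =
      ∑ i, (((l i : ℂ) - z)⁻¹) ^ 2 * (((Uᵀ *ᵥ x) i : ℝ) : ℂ) ^ 2 := by
  have h1 : (U.map Complex.ofRealHom)ᵀ * U.map Complex.ofRealHom = 1 := by
    rw [← transpose_map, ← Matrix.map_mul, h.left_inv, Matrix.map_one _ (map_zero _) (map_one _)]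
  rw [h.resolvent_eq hz, ← quad_conj]
  congr 1
  set V := U.map Complex.ofRealHom
  calc V * diagonal (fun i => ((l i : ℂ) - z)⁻¹) * Vᵀ *
        (V * diagonal (fun i => ((l i : ℂ) - z)⁻¹) * Vᵀ)
      = V * (diagonal (fun i => ((l i : ℂ) - z)⁻¹) * (Vᵀ * V) *
          diagonal (fun i => ((l i : ℂ) - z)⁻¹)) * Vᵀ := by simp only [mul_assoc]
    _ = _ := by simp only [h1, mul_one, diagonal_mul_diagonal, sq]

theorem sum_sq_mulVec (h : IsOrthDiag M U l) (x : Fin N → ℝ) :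
    ∑ i, (Uᵀ *ᵥ x) i ^ 2 = ∑ i, x i ^ 2 := by
  have : (Uᵀ *ᵥ x) ⬝ᵥ (Uᵀ *ᵥ x) = x ⬝ᵥ x := by
    rw [dotProduct_mulVec, ← mulVec_transpose, transpose_transpose, mulVec_mulVec, h.right_inv,
      one_mulVec]
  simpa [dotProduct, sq] using this

end IsOrthDiag

theorem norm_le_norm_sub {r : ℝ} (hr : 0 ≤ r) {z : ℂ} (hz : z.re < 0) : ‖z‖ ≤ ‖(r : ℂ) - z‖ := by
  rw [← abs_norm z, ← abs_norm ((r : ℂ) - z), ← sq_le_sq, ← Complex.normSq_eq_norm_sq,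
    ← Complex.normSq_eq_norm_sq, Complex.normSq_apply, Complex.normSq_apply]
  simp
  nlinarith

theorem norm_inv_sub_le {r : ℝ} (hr : 0 ≤ r) {z : ℂ} (hz : z.re < 0) :
    ‖((r : ℂ) - z)⁻¹‖ ≤ 1 / ‖z‖ := by
  rw [norm_inv, one_div]
  exact inv_anti₀ (norm_pos_iff.2 (ne_zero_of_re_neg hz)) (norm_le_norm_sub hr hz)

/-- The number $r-z$ lies in the cone of $z^{-1}$ with coefficients $r$ and 1. Quadratic forms of
resolvents are nonnegative combinations of such inverses, which is how the $g_k$ enter the cone. -/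
theorem inv_sub_mem_cone {r : ℝ} (hr : 0 ≤ r) {z : ℂ} (hz : z.re < 0) :
    ((r : ℂ) - z)⁻¹ ∈ cone z := by
  rw [← inv_inv z]
  refine inv_mem_cone (inv_ne_zero (ne_zero_of_re_neg hz)) ?_
  exact ⟨r, 1, hr, zero_le_one, by simp⟩

variable {M : Matrix (Fin N) (Fin N) ℝ} {z : ℂ}

theorem quad_resolvent_mem_cone (hM : M.PosSemidef) (hz : z.re < 0) (x : Fin N → ℝ) :
    quad (resolvent M z) x ∈ cone z := by
  obtain ⟨U, l, h, -⟩ := exists_isOrthDiag hM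
  rw [h.quad_resolvent hz]
  refine sum_mem_cone _ fun i => ?_
  rw [mul_comm, ← Complex.ofReal_pow]
  exact mul_mem_cone (sq_nonneg _) (inv_sub_mem_cone (h.nonneg i) hz)

theorem norm_quad_resolvent_le (hM : M.PosSemidef) (hz : z.re < 0) (x : Fin N → ℝ) :
    ‖quad (resolvent M z) x‖ ≤ 1 / ‖z‖ * ∑ i, x i ^ 2 := by
  obtain ⟨U, l, h, -⟩ := exists_isOrthDiag hM
  rw [h.quad_resolvent hz, ← h.sum_sq_mulVec x, Finset.mul_sum]
  refine norm_sum_le_of_le _ fun i _ => ?_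
  rw [norm_mul, norm_pow, Complex.norm_real, Real.norm_eq_abs, sq_abs]
  exact mul_le_mul_of_nonneg_right (norm_inv_sub_le (h.nonneg i) hz) (sq_nonneg _)

theorem resolvent_spec (hM : M.PosSemidef) (hz : z.re < 0) :
    (M.map (fun x : ℝ => (x : ℂ)) - z • (1 : Matrix (Fin N) (Fin N) ℂ)) * resolvent M z = 1 := by
  obtain ⟨U, l, h, -⟩ := exists_isOrthDiag hM
  rw [h.resolvent_eq hz]
  exact h.mul_resolvent_form hz

theorem resolvent_spec' (hM : M.PosSemidef) (hz : z.re < 0) :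
    resolvent M z * (M.map (fun x : ℝ => (x : ℂ)) - z • (1 : Matrix (Fin N) (Fin N) ℂ)) = 1 :=
  mul_eq_one_comm.1 (resolvent_spec hM hz)

/-- The numbers $(l_i-z)^{-1}$ have nonnegative real parts, and their imaginary parts all have the
sign of $\Im z$. Nothing cancels in the quadratic form $q$, so $\sum_i|l_i-z|^{-1}y_i\le\Re q+|\Im
q|$. The second resolvent factor costs $1/|z|$; the constant 2 counts the real and the imaginary
part. -/
theorem mul_norm_quad_resolvent_sq_le (hM : M.PosSemidef) (hz : z.re < 0) (x : Fin N → ℝ) {c : ℝ}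
    (hc : 0 ≤ c) : c * ‖quad (resolvent M z * resolvent M z) x‖ ≤
      2 / ‖z‖ * ‖1 + (c : ℂ) * quad (resolvent M z) x‖ := by
  obtain ⟨U, l, h, -⟩ := exists_isOrthDiag hM
  rw [h.quad_resolvent hz, h.quad_resolvent_sq hz]
  set y := fun i => (Uᵀ *ᵥ x) i ^ 2 with hy
  have hy0 : ∀ i, 0 ≤ y i := fun i => sq_nonneg _
  have hre : ∀ i, 0 ≤ (((l i : ℂ) - z)⁻¹).re := fun i =>
    re_nonneg_of_mem_cone hz (inv_sub_mem_cone (h.nonneg i) hz)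
  have him : ∀ i, (((l i : ℂ) - z)⁻¹).im = z.im * (Complex.normSq ((l i : ℂ) - z))⁻¹ := fun i => by
    rw [Complex.inv_im]
    simp [div_eq_mul_inv]
  have e1 : ∀ i, ((((Uᵀ *ᵥ x) i : ℝ) : ℂ)) ^ 2 = ((y i : ℝ) : ℂ) := fun i => by simp [hy]
  simp only [e1]
  set q := ∑ i, ((l i : ℂ) - z)⁻¹ * (y i : ℂ) with hq
  have hqre : q.re = ∑ i, (((l i : ℂ) - z)⁻¹).re * y i := by
    simp [hq, Complex.re_sum]
  have hqim : |q.im| = ∑ i, |(((l i : ℂ) - z)⁻¹).im| * y i := by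
    have : q.im = z.im * ∑ i, (Complex.normSq ((l i : ℂ) - z))⁻¹ * y i := by
      rw [hq, Complex.im_sum, Finset.mul_sum]
      exact Finset.sum_congr rfl fun i _ => by rw [Complex.im_mul_ofReal, him]; ring
    rw [this, abs_mul, abs_of_nonneg (a := ∑ i, _), Finset.mul_sum]
    · refine Finset.sum_congr rfl fun i _ => ?_
      rw [him, abs_mul, abs_of_nonneg (a := (_)⁻¹) (inv_nonneg.2 (Complex.normSq_nonneg _))]
      ring
    · exact Finset.sum_nonneg fun i _ =>
        mul_nonneg (inv_nonneg.2 (Complex.normSq_nonneg _)) (hy0 i)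
  have hsum : ‖∑ i, (((l i : ℂ) - z)⁻¹) ^ 2 * (y i : ℂ)‖ ≤ 1 / ‖z‖ * (q.re + |q.im|) := by
    rw [hqre, hqim, ← Finset.sum_add_distrib, Finset.mul_sum]
    refine norm_sum_le_of_le _ fun i _ => ?_
    rw [norm_mul, norm_pow, Complex.norm_real, Real.norm_of_nonneg (hy0 i), ← add_mul, ← mul_assoc,
      sq]
    refine mul_le_mul_of_nonneg_right (mul_le_mul (norm_inv_sub_le (h.nonneg i) hz) ?_
      (norm_nonneg _) (by positivity)) (hy0 i)
    have := Complex.norm_le_abs_re_add_abs_im (((l i : ℂ) - z)⁻¹)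
    rwa [abs_of_nonneg (hre i)] at this
  have h1 : c * (q.re + |q.im|) ≤ 2 * ‖1 + (c : ℂ) * q‖ := by
    have r1 := Complex.re_le_norm (1 + (c : ℂ) * q)
    have r2 := Complex.abs_im_le_norm (1 + (c : ℂ) * q)
    simp only [Complex.add_re, Complex.one_re, Complex.re_ofReal_mul] at r1
    simp only [Complex.add_im, Complex.one_im, Complex.im_ofReal_mul, zero_add, abs_mul,
      abs_of_nonneg hc] at r2
    linarith
  calc c * ‖∑ i, (((l i : ℂ) - z)⁻¹) ^ 2 * (y i : ℂ)‖
      ≤ c * (1 / ‖z‖ * (q.re + |q.im|)) := mul_le_mul_of_nonneg_left hsum hc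
    _ = 1 / ‖z‖ * (c * (q.re + |q.im|)) := by ring
    _ ≤ 1 / ‖z‖ * (2 * ‖1 + (c : ℂ) * q‖) := mul_le_mul_of_nonneg_left h1 (by positivity)
    _ = 2 / ‖z‖ * ‖1 + (c : ℂ) * q‖ := by ring

section RankOne

variable {M' : Matrix (Fin N) (Fin N) ℝ} {x : Fin N → ℝ} {c : ℝ}

theorem one_add_mul_quad_ne_zero (hM : M.PosSemidef) (hz : z.re < 0) (hc : 0 ≤ c) :
    1 + (c : ℂ) * quad (resolvent M z) x ≠ 0 :=
  one_add_mul_ne_zero hc (re_nonneg_of_mem_cone hz (quad_resolvent_mem_cone hM hz x))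

theorem map_rankOne (hMM : M' = M + c • vecMulVec x x) :
    M'.map (fun x : ℝ => (x : ℂ)) =
      M.map (fun x : ℝ => (x : ℂ)) + (c : ℂ) • vecMulVec (toC x) (toC x) := by
  rw [hMM]
  ext i j
  simp [toC, vecMulVec_apply]

/-- Sherman–Morrison: with $R$ the resolvent of $M$, the matrix $M'-z$ sends $Rx$ to $(1+cq)x$. -/
theorem resolvent_rankOne_mulVec (hM : M.PosSemidef) (hM' : M'.PosSemidef)
    (hMM : M' = M + c • vecMulVec x x) (hz : z.re < 0) (hc : 0 ≤ c) :
    resolvent M' z *ᵥ toC x =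
      (1 + (c : ℂ) * quad (resolvent M z) x)⁻¹ • resolvent M z *ᵥ toC x := by
  set q := quad (resolvent M z) x with hq
  have hq0 : 1 + (c : ℂ) * q ≠ 0 := one_add_mul_quad_ne_zero hM hz hc
  have h1 : (M'.map (fun x : ℝ => (x : ℂ)) - z • (1 : Matrix (Fin N) (Fin N) ℂ)) *ᵥ
      (resolvent M z *ᵥ toC x) = (1 + (c : ℂ) * q) • toC x := by
    rw [map_rankOne hMM, add_sub_right_comm, add_mulVec, mulVec_mulVec, resolvent_spec hM hz,
      one_mulVec, smul_mulVec, vecMulVec_mulVec, add_smul, one_smul, hq, quad, op_smul_eq_smul, smul_smul]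
  have h2 := congrArg (resolvent M' z *ᵥ ·) h1
  simp only [mulVec_mulVec (resolvent M z *ᵥ toC x), resolvent_spec' hM' hz, one_mulVec,
    mulVec_smul] at h2
  rw [h2, smul_smul, inv_mul_cancel₀ hq0, one_smul]

theorem quad_resolvent_rankOne (hM : M.PosSemidef) (hM' : M'.PosSemidef)
    (hMM : M' = M + c • vecMulVec x x) (hz : z.re < 0) (hc : 0 ≤ c) :
    quad (resolvent M' z) x =
      quad (resolvent M z) x / (1 + (c : ℂ) * quad (resolvent M z) x) := by
  conv_lhs => rw [quad, resolvent_rankOne_mulVec hM hM' hMM hz hc, dotProduct_smul]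
  rw [smul_eq_mul, mul_comm, div_eq_mul_inv]
  rfl

/-- The resolvent identity makes the difference a rank-one matrix, whose trace is a scalar product
evaluated by `resolvent_rankOne_mulVec`. -/
theorem trace_resolvent_rankOne (hM : M.PosSemidef) (hM' : M'.PosSemidef)
    (hMM : M' = M + c • vecMulVec x x) (hz : z.re < 0) (hc : 0 ≤ c) :
    (resolvent M' z).trace - (resolvent M z).trace =
      -(c * quad (resolvent M z * resolvent M z) x / (1 + (c : ℂ) * quad (resolvent M z) x)) := by
  have h1 : resolvent M' z - resolvent M z =
      -((c : ℂ) • (resolvent M' z * vecMulVec (toC x) (toC x) * resolvent M z)) := by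
    set B := M.map (fun x : ℝ => (x : ℂ)) - z • (1 : Matrix (Fin N) (Fin N) ℂ) with hB
    set B' := M'.map (fun x : ℝ => (x : ℂ)) - z • (1 : Matrix (Fin N) (Fin N) ℂ) with hB'
    have h2 : B' - B = (c : ℂ) • vecMulVec (toC x) (toC x) := by
      rw [hB, hB', map_rankOne hMM]
      abel
    have e1 : resolvent M' z * B' * resolvent M z = resolvent M z := by
      rw [resolvent_spec' hM' hz, one_mul]
    have e2 : resolvent M' z * B * resolvent M z = resolvent M' z := by
      rw [mul_assoc, resolvent_spec hM hz, mul_one]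
    rw [← Matrix.smul_mul, ← Matrix.mul_smul, ← h2, Matrix.mul_sub, Matrix.sub_mul, e1, e2]
    abel
  rw [← trace_sub, h1, trace_neg, trace_smul, mul_vecMulVec, vecMulVec_mul, trace_vecMulVec,
    resolvent_rankOne_mulVec hM hM' hMM hz hc, smul_dotProduct, dotProduct_comm,
    ← dotProduct_mulVec, mulVec_mulVec]
  simp only [smul_eq_mul, quad]
  ring

/-- The bound involves neither $c$, $x$ nor $N$, so after division by $N$ removing one mode costs
only $O(1/N)$. -/
theorem norm_trace_resolvent_rankOne_le (hM : M.PosSemidef) (hM' : M'.PosSemidef)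
    (hMM : M' = M + c • vecMulVec x x) (hz : z.re < 0) (hc : 0 ≤ c) :
    ‖(resolvent M' z).trace - (resolvent M z).trace‖ ≤ 2 / ‖z‖ := by
  have h0 := norm_pos_iff.2 (one_add_mul_quad_ne_zero (x := x) hM hz hc)
  rw [trace_resolvent_rankOne hM hM' hMM hz hc, norm_neg, norm_div, norm_mul, Complex.norm_real,
    Real.norm_of_nonneg hc, div_le_iff₀ h0]
  exact mul_norm_quad_resolvent_sq_le hM hz x hc

end RankOne

end Resolvent

/-! ### Moments of Gaussian quadratic forms -/

section Chi

open Matrix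

variable {N : ℕ}

theorem integral_exp_sq_sub_one {u : ℝ} (hu : u < 1 / 2) :
    ∫ y, Real.exp (u * (y ^ 2 - 1)) ∂(gaussianReal 0 1) =
      Real.exp (-u) * √(1 / (1 - 2 * u)) := by
  rw [integral_gaussianReal_eq_integral_smul one_ne_zero]
  have h : ∀ x : ℝ, gaussianPDFReal 0 1 x • Real.exp (u * (x ^ 2 - 1)) =
      (√(2 * Real.pi))⁻¹ * Real.exp (-u) * Real.exp (-(1 / 2 - u) * x ^ 2) := fun x => by
    simp only [gaussianPDFReal, NNReal.coe_one, mul_one, sub_zero, smul_eq_mul]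
    rw [mul_assoc (√(2 * Real.pi))⁻¹, mul_assoc (√(2 * Real.pi))⁻¹, ← Real.exp_add,
      ← Real.exp_add]
    congr 2
    ring
  simp only [h]
  rw [integral_const_mul, integral_gaussian, mul_comm (_)⁻¹, mul_assoc, ← Real.sqrt_inv,
    ← Real.sqrt_mul (by positivity)]
  congr 2
  have := Real.pi_pos
  have : 1 - 2 * u ≠ 0 := by linarith
  have : 1 / 2 - u ≠ 0 := by linarith
  field_simp

/-- The integral of a non-integrable function is 0 by convention, whereas the computed value is
positive. -/
theorem integrable_exp_sq_sub_one {u : ℝ} (hu : u < 1 / 2) :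
    Integrable (fun y : ℝ => Real.exp (u * (y ^ 2 - 1))) (gaussianReal 0 1) := by
  by_contra h
  have h1 := integral_exp_sq_sub_one hu
  rw [integral_undef h] at h1
  have : 0 < 1 - 2 * u := by linarith
  have : 0 < Real.exp (-u) * √(1 / (1 - 2 * u)) := by positivity
  linarith

theorem integral_exp_sq_sub_one_le {u : ℝ} (hu : |u| ≤ 1 / 4) :
    ∫ y, Real.exp (u * (y ^ 2 - 1)) ∂(gaussianReal 0 1) ≤ Real.exp (4 * u ^ 2) := by
  obtain ⟨h1, h2⟩ := abs_le.1 hu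
  have h0 : 0 < 1 - 2 * u := by linarith
  rw [integral_exp_sq_sub_one (by linarith), Real.exp_neg, inv_mul_le_iff₀ (Real.exp_pos _),
    ← Real.exp_add, Real.sqrt_le_iff]
  refine ⟨by positivity, ?_⟩
  rw [← Real.exp_nat_mul, div_le_iff₀ h0]
  have h3 : (1 + 8 * u ^ 2) * (1 + 2 * u) ≤ Real.exp (((2 : ℕ) : ℝ) * (u + 4 * u ^ 2)) := by
    have e : ((2 : ℕ) : ℝ) * (u + 4 * u ^ 2) = 8 * u ^ 2 + 2 * u := by push_cast; ring
    rw [e, Real.exp_add]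
    have a1 := Real.add_one_le_exp (8 * u ^ 2)
    have a2 := Real.add_one_le_exp (2 * u)
    exact mul_le_mul (by linarith) (by linarith) (by linarith) (by positivity)
  have h4 : u ^ 2 ≤ 1 / 16 := by nlinarith
  -- The product is $(1+8u^2)(1-4u^2)=1+4u^2-32u^4$, at least 1 as soon as $u^2\le1/8$.
  have h5 : 1 ≤ (1 + 8 * u ^ 2) * (1 + 2 * u) * (1 - 2 * u) := by nlinarith [sq_nonneg u]
  exact h5.trans (mul_le_mul_of_nonneg_right h3 h0.le)

/-- The centered weighted chi-square variable `∑ aᵢ (yᵢ² - 1)`. -/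
def chi (a y : Fin N → ℝ) : ℝ := ∑ i, a i * (y i ^ 2 - 1)

theorem exp_chi (t : ℝ) (a y : Fin N → ℝ) :
    Real.exp (t * chi a y) = ∏ i, Real.exp (t * a i * (y i ^ 2 - 1)) := by
  rw [← Real.exp_sum, chi, Finset.mul_sum]
  simp only [mul_assoc]

theorem integrable_exp_chi {a : Fin N → ℝ} {t : ℝ} (h : ∀ i, |t * a i| ≤ 1 / 4) :
    Integrable (fun y => Real.exp (t * chi a y)) (stdNormal N) := by
  simp only [exp_chi]
  refine Integrable.fintype_prod (f := fun i (x : ℝ) => Real.exp (t * a i * (x ^ 2 - 1))) fun i => ?_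
  exact integrable_exp_sq_sub_one (by linarith [(abs_le.1 (h i)).2])

theorem integral_exp_chi_le {a : Fin N → ℝ} {t : ℝ} (h : ∀ i, |t * a i| ≤ 1 / 4) :
    ∫ y, Real.exp (t * chi a y) ∂(stdNormal N) ≤ Real.exp (∑ i, 4 * (t * a i) ^ 2) := by
  simp only [exp_chi]
  rw [integral_fintype_prod_eq_prod (f := fun i (x : ℝ) => Real.exp (t * a i * (x ^ 2 - 1))),
    Real.exp_sum]
  exact Finset.prod_le_prod (fun i _ => integral_nonneg fun _ => (Real.exp_pos _).le)
    fun i _ => integral_exp_sq_sub_one_le (h i)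

theorem measurable_chi (a : Fin N → ℝ) : Measurable (chi a) := by
  unfold chi
  fun_prop

/-- Moments are read off from exponential moments at scale $D$, through $|x|^p\le
p!\,D^p\,e^{|x|/D}$. -/
theorem moment_chi_le (hN : 0 < N) {a : Fin N → ℝ} {A : ℝ} (hA : 0 < A) (ha : ∀ i, |a i| ≤ A)
    (p : ℕ) : Integrable (fun y => |chi a y| ^ p) (stdNormal N) ∧
      ∫ y, |chi a y| ^ p ∂(stdNormal N) ≤ 4 * p.factorial * (4 * A * √N) ^ p := by
  have hNr : (1 : ℝ) ≤ N := by exact_mod_cast hN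
  have hs1 : 1 ≤ √(N : ℝ) := Real.one_le_sqrt.2 hNr
  -- At this scale each weight is at most $1/(4\sqrt N)$: small enough for the one-variable bound,
  -- and with $\sum_i4(a_i/D)^2\le1/4$. Each of the two exponential moments is then at most
  -- $e^{1/4}\le2$, whence the constant 4.
  set D := 4 * A * √N with hD
  have hDpos : 0 < D := by positivity
  have hb : ∀ i, |1 / D * a i| ≤ 1 / (4 * √N) := fun i => by
    rw [abs_mul, abs_of_pos (by positivity)]
    calc 1 / D * |a i| ≤ 1 / D * A := mul_le_mul_of_nonneg_left (ha i) (by positivity)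
      _ = 1 / (4 * √N) := by rw [hD]; field_simp
  have hb4 : 1 / (4 * √(N : ℝ)) ≤ 1 / 4 :=
    one_div_le_one_div_of_le (by norm_num) (by linarith)
  have h1 : ∀ i, |1 / D * a i| ≤ 1 / 4 := fun i => (hb i).trans hb4
  have h2 : ∀ i, |-(1 / D) * a i| ≤ 1 / 4 := fun i => by rw [neg_mul, abs_neg]; exact h1 i
  have hsum : ∑ i, 4 * (1 / D * a i) ^ 2 ≤ 1 / 4 := by
    calc ∑ i, 4 * (1 / D * a i) ^ 2 ≤ ∑ _i : Fin N, 4 * (1 / (4 * √(N : ℝ))) ^ 2 := by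
          refine Finset.sum_le_sum fun i _ => ?_
          have := sq_le_sq.2 ((hb i).trans (le_abs_self _))
          linarith
      _ = 1 / 4 := by
          have : √(N : ℝ) ^ 2 = N := Real.sq_sqrt (by positivity)
          rw [Finset.sum_const, Finset.card_univ, Fintype.card_fin, nsmul_eq_mul, div_pow, mul_pow,
            this]
          field_simp
  have hexp : Real.exp (1 / 4) ≤ 2 := by
    have := Real.exp_one_lt_three
    have h4 : Real.exp (1 / 4) ^ 4 = Real.exp 1 := by
      rw [← Real.exp_nat_mul]; norm_num
    by_contra hlt
    push Not at hlt
    have := pow_lt_pow_left₀ hlt (by norm_num) (n := 4) (by norm_num)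
    norm_num at this
    linarith
  have i1 := integral_exp_chi_le h1
  have i2 := integral_exp_chi_le h2
  have hsum' : ∑ i, 4 * (-(1 / D) * a i) ^ 2 ≤ 1 / 4 := by
    simpa only [neg_mul, neg_sq] using hsum
  have j1 := (i1.trans (Real.exp_le_exp.2 hsum)).trans hexp
  have j2 := (i2.trans (Real.exp_le_exp.2 hsum')).trans hexp
  have hint := ((integrable_exp_chi h1).add (integrable_exp_chi h2)).const_mul
    (p.factorial * D ^ p)
  have hle : ∀ y, |chi a y| ^ p ≤ p.factorial * D ^ p *
      (Real.exp (1 / D * chi a y) + Real.exp (-(1 / D) * chi a y)) := fun y => by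
    have k1 := Real.pow_div_factorial_le_exp (|chi a y| / D) (by positivity) p
    have k2 : Real.exp (|chi a y| / D) ≤
        Real.exp (1 / D * chi a y) + Real.exp (-(1 / D) * chi a y) := by
      rcases abs_choice (chi a y) with h | h <;> rw [h]
      · have e : chi a y / D = 1 / D * chi a y := by ring
        rw [e]
        exact le_add_of_nonneg_right (Real.exp_pos _).le
      · have e : -chi a y / D = -(1 / D) * chi a y := by ring
        rw [e]
        exact le_add_of_nonneg_left (Real.exp_pos _).le
    have k3 := k1.trans k2
    rw [div_pow, div_div, div_le_iff₀ (by positivity)] at k3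
    linarith
  have hI : Integrable (fun y => |chi a y| ^ p) (stdNormal N) := by
    refine hint.mono' ((measurable_chi a).abs.pow_const p).aestronglyMeasurable
      (Eventually.of_forall fun y => ?_)
    rw [Real.norm_of_nonneg (by positivity)]
    exact hle y
  refine ⟨hI, (integral_mono hI hint hle).trans ?_⟩
  rw [integral_const_mul]
  simp only [Pi.add_apply]
  rw [integral_add (integrable_exp_chi h1) (integrable_exp_chi h2)]
  have : (0 : ℝ) ≤ p.factorial * D ^ p := by positivity
  nlinarith

/-- Real and imaginary parts are treated separately; adding them doubles both the prefactor and the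
scale. -/
theorem moment_chi_complex_le (hN : 0 < N) {c : Fin N → ℂ} {A : ℝ} (hA : 0 < A)
    (hc : ∀ i, ‖c i‖ ≤ A) (p : ℕ) :
    Integrable (fun y => ‖∑ i, c i * (((y i : ℝ) : ℂ) ^ 2 - 1)‖ ^ p) (stdNormal N) ∧
      ∫ y, ‖∑ i, c i * (((y i : ℝ) : ℂ) ^ 2 - 1)‖ ^ p ∂(stdNormal N) ≤
        8 * p.factorial * (8 * A * √N) ^ p := by
  obtain ⟨i1, b1⟩ := moment_chi_le hN hA (a := fun i => (c i).re)
    (fun i => (Complex.abs_re_le_norm _).trans (hc i)) p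
  obtain ⟨i2, b2⟩ := moment_chi_le hN hA (a := fun i => (c i).im)
    (fun i => (Complex.abs_im_le_norm _).trans (hc i)) p
  have hle : ∀ y : Fin N → ℝ, ‖∑ i, c i * (((y i : ℝ) : ℂ) ^ 2 - 1)‖ ^ p ≤
      2 ^ p * (|chi (fun i => (c i).re) y| ^ p + |chi (fun i => (c i).im) y| ^ p) := fun y => by
    have e : ∀ i, c i * (((y i : ℝ) : ℂ) ^ 2 - 1) = c i * ((y i ^ 2 - 1 : ℝ) : ℂ) := fun i => by
      push_cast; rfl
    have h1 := Complex.norm_le_abs_re_add_abs_im (∑ i, c i * (((y i : ℝ) : ℂ) ^ 2 - 1))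
    simp only [e, Complex.re_sum, Complex.im_sum, Complex.re_mul_ofReal,
      Complex.im_mul_ofReal] at h1 ⊢
    refine (pow_le_pow_left₀ (norm_nonneg _) h1 p).trans ?_
    refine (add_pow_le (abs_nonneg _) (abs_nonneg _) p).trans ?_
    refine mul_le_mul_of_nonneg_right (pow_le_pow_right₀ one_le_two (Nat.sub_le p 1)) ?_
    positivity
  have hint := (i1.add i2).const_mul (2 ^ p)
  have hI : Integrable (fun y => ‖∑ i, c i * (((y i : ℝ) : ℂ) ^ 2 - 1)‖ ^ p) (stdNormal N) := by
    refine hint.mono' (Measurable.aestronglyMeasurable (by fun_prop))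
      (Eventually.of_forall fun y => ?_)
    rw [Real.norm_of_nonneg (by positivity)]
    exact hle y
  refine ⟨hI, (integral_mono hI hint hle).trans ?_⟩
  rw [integral_const_mul]
  simp only [Pi.add_apply]
  rw [integral_add i1 i2]
  have e : (8 * A * √(N : ℝ)) ^ p = 2 ^ p * (4 * A * √N) ^ p := by rw [← mul_pow]; ring
  rw [e]
  have : (0 : ℝ) ≤ 2 ^ p := by positivity
  nlinarith

/-- Concentration of the quadratic form of a resolvent at a standard Gaussian vector. -/
theorem lintegral_quad_resolvent_sub_trace_le (hN : 0 < N) {M : Matrix (Fin N) (Fin N) ℝ}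
    (hM : M.PosSemidef) {z : ℂ} (hz : z.re < 0) (p : ℕ) :
    ∫⁻ x, ‖quad (resolvent M z) x - (resolvent M z).trace‖ₑ ^ p ∂(stdNormal N) ≤
      ENNReal.ofReal (8 * p.factorial * (8 * (1 / ‖z‖) * √N) ^ p) := by
  have hzn := norm_pos_iff.2 (ne_zero_of_re_neg hz)
  obtain ⟨U, l, h, hU⟩ := exists_isOrthDiag hM
  have hmeas : Measurable fun x => ‖quad (resolvent M z) x - (resolvent M z).trace‖ₑ ^ p :=
    ((measurable_quad_resolvent (M := fun _ : Fin N → ℝ => M) (x := fun x => x)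
      (fun _ _ => measurable_const) (fun i => measurable_pi_apply i) z).sub_const _).enorm.pow_const p
  -- By rotation invariance $x$ may be replaced by $Uy$, which diagonalizes the form and leaves a
  -- weighted sum of the $y_i^2-1$.
  rw [← hU.lintegral_comp hmeas]
  obtain ⟨hI, hb⟩ := moment_chi_complex_le hN (c := fun i => ((l i : ℂ) - z)⁻¹)
    (A := 1 / ‖z‖) (by positivity) (fun i => norm_inv_sub_le (h.nonneg i) hz) p
  have e : ∀ y : Fin N → ℝ, quad (resolvent M z) (U *ᵥ y) - (resolvent M z).trace =
      ∑ i, ((l i : ℂ) - z)⁻¹ * (((y i : ℝ) : ℂ) ^ 2 - 1) := fun y => by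
    rw [h.quad_resolvent hz, h.trace_resolvent hz, mulVec_mulVec, h.left_inv, one_mulVec,
      ← Finset.sum_sub_distrib]
    exact Finset.sum_congr rfl fun i _ => by ring
  have e2 : ∀ y : Fin N → ℝ, ‖quad (resolvent M z) (U *ᵥ y) - (resolvent M z).trace‖ₑ ^ p =
      ENNReal.ofReal (‖∑ i, ((l i : ℂ) - z)⁻¹ * (((y i : ℝ) : ℂ) ^ 2 - 1)‖ ^ p) := fun y => by
    rw [e, ENNReal.ofReal_pow (norm_nonneg _), ofReal_norm]
  simp only [e2]
  rw [← ofReal_integral_eq_lintegral_ofReal hI (Eventually.of_forall fun _ => by positivity)]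
  exact ENNReal.ofReal_le_ofReal hb

end Chi

/-! ### Gaussian observations -/

section Gaussian

variable {X : Type*} [TopologicalSpace X] [CompactSpace X] {π : Measure (Observation X)}

theorem measurable_eval (f : C(X, ℝ)) : Measurable fun o : Observation X => o f := by
  refine measurable_iff_comap_le.2 ?_
  rw [BorelSpace.measurable_eq (α := ℝ)]
  exact le_iSup (fun f : C(X, ℝ) =>
    MeasurableSpace.comap (fun o : Observation X => o f) (borel ℝ)) f

/-- A linear form in finitely many evaluations of $o$ is again an evaluation of $o$, at a linear
combination of the functions. -/
theorem IsGaussianObservation.isGaussianProcess (hπ : IsGaussianObservation π) {τ : Type*}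
    (g : τ → C(X, ℝ)) : IsGaussianProcess (fun t (o : Observation X) => o (g t)) π := by
  refine ⟨fun I => ⟨⟨fun L => ?_⟩⟩⟩
  classical
  have hR : Measurable fun o : Observation X => I.restrict (fun t => o (g t)) :=
    measurable_pi_lambda _ fun i => measurable_eval _
  have hL : ∀ o : Observation X, L (I.restrict (fun t => o (g t))) =
      o (∑ i : I, L (Pi.single i 1) • g i) := fun o => by
    conv_lhs => rw [← L.sum_comp_single]
    rw [map_sum]
    refine Finset.sum_congr rfl fun i _ => ?_
    have : ContinuousLinearMap.single ℝ (fun _ : I => ℝ) i (I.restrict (fun t => o (g t)) i) =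
        o (g i) • Pi.single i (1 : ℝ) := by
      ext j
      by_cases h : j = i
      · subst h; simp
      · simp [h]
    rw [ContinuousLinearMap.comp_apply, this, map_smul, map_smul, smul_eq_mul, smul_eq_mul,
      mul_comm]
  have hc : L ∘ (fun o : Observation X => I.restrict (fun t => o (g t))) =
      fun o : Observation X => o (∑ i : I, L (Pi.single i 1) • g i) := funext hL
  rw [Measure.map_map (by fun_prop) hR, integral_map hR.aemeasurable (by fun_prop),
    variance_map (by fun_prop) hR.aemeasurable, hc]
  simp only [hL]
  exact (hπ.gaussian _).map_eq_gaussianReal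

theorem IsGaussianObservation.map_eval (hπ : IsGaussianObservation π) {h : C(X, ℝ)}
    (h1 : innerS π h h = 1) : π.map (fun o => o h) = gaussianReal 0 1 := by
  rw [(hπ.gaussian h).map_eq_gaussianReal, hπ.centered h,
    variance_of_integral_eq_zero (measurable_eval h).aemeasurable (hπ.centered h)]
  have : ∫ o, o h ^ 2 ∂π = 1 := by simpa only [innerS, sq] using h1
  rw [this, Real.toNNReal_one]

variable [IsProbabilityMeasure π]

/-- The evaluations at $h$ and at all the `F l` form one Gaussian process, in which zero covariance
means independence. -/
theorem IsGaussianObservation.indepFun (hπ : IsGaussianObservation π) {h : C(X, ℝ)} {κ : Type*}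
    {F : κ → C(X, ℝ)} (hF : ∀ l, innerS π h (F l) = 0) :
    IndepFun (fun o : Observation X => o h) (fun (o : Observation X) l => o (F l)) π := by
  have hp : IsGaussianProcess (Sum.elim (fun (_ : Unit) (o : Observation X) => o h)
      (fun l (o : Observation X) => o (F l))) π := by
    convert hπ.isGaussianProcess (Sum.elim (fun _ : Unit => h) F) using 1
    ext (_ | l) o <;> rfl
  have := hp.indepFun_of_covariance_eq_zero (fun _ => (measurable_eval h).aemeasurable)
    (fun l => (measurable_eval (F l)).aemeasurable) fun _ l => by
      rw [covariance_eq_sub (hπ.gaussian h).memLp_two (hπ.gaussian (F l)).memLp_two, hπ.centered h,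
        zero_mul, sub_zero]
      exact hF l
  exact this.comp (measurable_pi_apply ()) measurable_id

variable {N : ℕ}

/-- The observations of `h` form a standard Gaussian vector that is independent of the
observations of functions orthogonal to `h`. -/
theorem IsGaussianObservation.map_pi (hπ : IsGaussianObservation π) {h : C(X, ℝ)}
    (h1 : innerS π h h = 1) {κ : Type*} {F : κ → C(X, ℝ)} (hF : ∀ l, innerS π h (F l) = 0) :
    (Measure.pi fun _ : Fin N => π).map
        (fun o => ((fun i => o i h : Fin N → ℝ), (fun i l => o i (F l) : Fin N → κ → ℝ))) =
      (stdNormal N).prod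
        ((Measure.pi fun _ : Fin N => π).map fun o => (fun i l => o i (F l) : Fin N → κ → ℝ)) := by
  have mF : Measurable fun (o : Observation X) l => o (F l) :=
    measurable_pi_lambda _ fun l => measurable_eval _
  have mh := measurable_eval h
  set ν := π.map (fun (o : Observation X) l => o (F l)) with hν
  have : IsProbabilityMeasure ν := Measure.isProbabilityMeasure_map mF.aemeasurable
  have hpair : MeasurePreserving (fun o : Observation X => (o h, fun l => o (F l))) π
      ((gaussianReal 0 1).prod ν) := by
    refine ⟨mh.prodMk mF, ?_⟩
    rw [(hπ.indepFun hF).map_prod_eq_prod_map_map mh.aemeasurable mF.aemeasurable,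
      hπ.map_eval h1]
  have h2 := (measurePreserving_arrowProdEquivProdArrow ℝ (κ → ℝ) (Fin N)
    (fun _ => gaussianReal 0 1) (fun _ => ν)).comp
    (measurePreserving_pi (fun _ : Fin N => π) _ fun _ => hpair)
  have h3 := (measurePreserving_pi (fun _ : Fin N => π) (fun _ => ν) fun _ =>
    (⟨mF, rfl⟩ : MeasurePreserving _ π ν)).map_eq
  rw [h3]
  exact h2.map_eq

/-- The Fubini form of `map_pi`: the observations of the functions orthogonal to $h$ can be frozen
while the Gaussian vector is averaged. -/
theorem IsGaussianObservation.lintegral_eq (hπ : IsGaussianObservation π) {h : C(X, ℝ)}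
    (h1 : innerS π h h = 1) {κ : Type*} {F : κ → C(X, ℝ)} (hF : ∀ l, innerS π h (F l) = 0)
    {Φ : (Fin N → ℝ) × (Fin N → κ → ℝ) → ENNReal} (hΦ : Measurable Φ) :
    ∫⁻ o, Φ (fun i => o i h, fun i l => o i (F l)) ∂(Measure.pi fun _ : Fin N => π) =
      ∫⁻ o, ∫⁻ x, Φ (x, fun i l => o i (F l)) ∂(stdNormal N) ∂(Measure.pi fun _ : Fin N => π) := by
  have mF : Measurable fun o : Fin N → Observation X => (fun i l => o i (F l) : Fin N → κ → ℝ) :=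
    measurable_pi_lambda _ fun i => measurable_pi_lambda _ fun l =>
      (measurable_eval _).comp (measurable_pi_apply i)
  have mh : Measurable fun o : Fin N → Observation X => (fun i => o i h : Fin N → ℝ) :=
    measurable_pi_lambda _ fun i => (measurable_eval _).comp (measurable_pi_apply i)
  have : IsProbabilityMeasure
      ((Measure.pi fun _ : Fin N => π).map fun o => (fun i l => o i (F l) : Fin N → κ → ℝ)) :=
    Measure.isProbabilityMeasure_map mF.aemeasurable
  rw [← lintegral_map (f := Φ) hΦ (mh.prodMk mF), hπ.map_pi h1 hF,
    lintegral_prod_symm _ hΦ.aemeasurable,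
    lintegral_map (f := fun y => ∫⁻ x, Φ (x, y) ∂(stdNormal N)) hΦ.lintegral_prod_left' mF]

end Gaussian

/-! ### Gram matrices -/

section Gram

open Matrix

variable {X : Type*} [TopologicalSpace X] [CompactSpace X] {ι : Type*} {N : ℕ}

theorem kernelMap_apply (K : C(X × X, ℝ)) (μ : Observation X) (x : X) :
    kernelMap K μ x = μ (K.curry x) := rfl

theorem kernelMap_eq_comp (K : C(X × X, ℝ)) (μ : Observation X) :
    kernelMap K μ = (⟨μ, (WeakDual.toStrongDual μ).continuous⟩ : C(C(X, ℝ), ℝ)).comp K.curry := by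
  ext x
  rfl

/-- The kernel map as a function of the kernel. -/
noncomputable def kernelMapHom (μ : Observation X) : C(X × X, ℝ) →+ C(X, ℝ) where
  toFun K := kernelMap K μ
  map_zero' := by
    ext x
    have : (0 : C(X × X, ℝ)).curry x = 0 := by ext; rfl
    rw [kernelMap_apply, this, map_zero, ContinuousMap.zero_apply]
  map_add' K K' := by
    ext x
    have : (K + K').curry x = K.curry x + K'.curry x := by ext; rfl
    rw [kernelMap_apply, this, map_add, ContinuousMap.add_apply, kernelMap_apply, kernelMap_apply]

theorem kernelMap_smul_tensor (c : ℝ) (f : C(X, ℝ)) (μ : Observation X) :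
    kernelMap (c • tensor f f) μ = (c * μ f) • f := by
  ext x
  have : (c • tensor f f).curry x = (c * f x) • f := by
    ext y
    change c * (f x * f y) = c * f x * f y
    ring
  rw [kernelMap_apply, this, map_smul, smul_eq_mul, ContinuousMap.smul_apply, smul_eq_mul]
  ring

variable [T2Space X]

theorem continuous_kernelMapHom (μ : Observation X) : Continuous (kernelMapHom μ) := by
  have : ⇑(kernelMapHom μ) = fun K : C(X × X, ℝ) =>
      (⟨μ, (WeakDual.toStrongDual μ).continuous⟩ : C(C(X, ℝ), ℝ)).comp K.curry :=
    funext fun K => kernelMap_eq_comp K μ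
  rw [this]
  exact (ContinuousMap.continuous_postcomp _).comp ContinuousMap.continuous_curry

theorem hasSum_kernelMap {K : C(X × X, ℝ)} {d : ι → ℝ} {f : ι → C(X, ℝ)}
    (hK : HasSum (fun k => d k • tensor (f k) (f k)) K) (μ : Observation X) :
    HasSum (fun k => (d k * μ (f k)) • f k) (kernelMap K μ) := by
  have := hK.map (kernelMapHom μ) (continuous_kernelMapHom μ)
  have e : kernelMapHom μ ∘ (fun k => d k • tensor (f k) (f k)) = fun k => (d k * μ (f k)) • f k :=
    funext fun k => kernelMap_smul_tensor (d k) (f k) μ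
  rw [e] at this
  exact this

/-- Uniform convergence of the kernel series passes through two continuous linear forms, so the
expansion holds for every $o$, not just almost surely. It exhibits the Gram matrix as a function of
the values $o_i(f^{(k)})$, from which positivity, measurability and independence follow. -/
theorem hasSum_gram {K : C(X × X, ℝ)} {d : ι → ℝ} {f : ι → C(X, ℝ)}
    (hK : HasSum (fun k => d k • tensor (f k) (f k)) K) (o : Fin N → Observation X)
    (i j : Fin N) : HasSum (fun k => d k * o i (f k) * o j (f k)) (gram K o i j) := by
  have := (hasSum_kernelMap hK (o j)).map (WeakDual.toStrongDual (o i))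
    (WeakDual.toStrongDual (o i)).continuous
  have e : WeakDual.toStrongDual (o i) ∘ (fun k => (d k * o j (f k)) • f k) =
      fun k => d k * o i (f k) * o j (f k) := by
    ext k
    simp only [Function.comp_apply, map_smul, smul_eq_mul, WeakDual.toStrongDual_apply]
    ring
  rw [e] at this
  exact this

theorem posSemidef_gram {K : C(X × X, ℝ)} {d : ι → ℝ} {f : ι → C(X, ℝ)}
    (hK : HasSum (fun k => d k • tensor (f k) (f k)) K) (hd : ∀ k, 0 ≤ d k)
    (o : Fin N → Observation X) : (gram K o).PosSemidef := by
  refine .of_dotProduct_mulVec_nonneg ?_ fun x => ?_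
  · ext i j
    rw [Matrix.conjTranspose_apply, star_trivial]
    refine (hasSum_gram hK o j i).unique ?_
    convert hasSum_gram hK o i j using 2
    ring
  · have h : HasSum (fun k => ∑ i, x i * ∑ j, d k * o i (f k) * o j (f k) * x j)
        (x ⬝ᵥ gram K o *ᵥ x) :=
      hasSum_sum fun i _ => (hasSum_sum fun j _ => (hasSum_gram hK o i j).mul_right _).mul_left _
    rw [star_trivial]
    refine h.nonneg fun k => ?_
    have e : ∑ i, x i * ∑ j, d k * o i (f k) * o j (f k) * x j =
        d k * (∑ i, x i * o i (f k)) ^ 2 := by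
      rw [sq, Finset.sum_mul_sum, Finset.mul_sum]
      refine Finset.sum_congr rfl fun i _ => ?_
      rw [Finset.mul_sum, Finset.mul_sum]
      exact Finset.sum_congr rfl fun j _ => by ring
    rw [e]
    exact mul_nonneg (hd k) (sq_nonneg _)

theorem measurable_gram_apply [Countable ι] {K : C(X × X, ℝ)} {d : ι → ℝ} {f : ι → C(X, ℝ)}
    (hK : HasSum (fun k => d k • tensor (f k) (f k)) K) (i j : Fin N) :
    Measurable fun o : Fin N → Observation X => gram K o i j := by
  simp only [← fun o => (hasSum_gram hK o i j).tsum_eq]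
  refine Measurable.tsum fun k => ?_
  exact (((measurable_eval _).comp (measurable_pi_apply i)).const_mul _).mul
    ((measurable_eval _).comp (measurable_pi_apply j))

end Gram

/-! ### Leave-one-out: the equation for $m_G$ and the fluctuations of $m_G-g_k$ -/

section Fluctuation

open Matrix

variable {X : Type*} [TopologicalSpace X] [CompactSpace X] {ι : Type*} {N : ℕ}
  {π : Measure (Observation X)} {K : C(X × X, ℝ)} {d : ι → ℝ} {f : ι → C(X, ℝ)} {z : ℂ}

theorem inv_shiftedGram (K : C(X × X, ℝ)) (o : Fin N → Observation X) (z : ℂ) :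
    (shiftedGram K o z)⁻¹ = resolvent ((1 / N : ℝ) • gram K o) z := by
  have : (1 / N : ℂ) • (gram K o).map (fun x : ℝ => (x : ℂ)) =
      ((1 / N : ℝ) • gram K o).map (fun x : ℝ => (x : ℂ)) := by
    ext i j
    simp
  rw [shiftedGram, this, resolvent]

theorem stieltjes_eq (K : C(X × X, ℝ)) (o : Fin N → Observation X) (z : ℂ) :
    stieltjes K o z = 1 / N * (resolvent ((1 / N : ℝ) • gram K o) z).trace := by
  rw [stieltjes, inv_shiftedGram]

theorem gFun_eq (K : C(X × X, ℝ)) (c : ℝ) (h : C(X, ℝ)) (o : Fin N → Observation X) (z : ℂ) :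
    gFun K c h o z = 1 / N *
      quad (resolvent ((1 / N : ℝ) • gram (K - c • tensor h h) o) z) fun i => o i h := by
  rw [gFun, inv_shiftedGram]
  rfl

theorem gram_eq_add (K : C(X × X, ℝ)) (c : ℝ) (h : C(X, ℝ)) (o : Fin N → Observation X) :
    (1 / N : ℝ) • gram K o = (1 / N : ℝ) • gram (K - c • tensor h h) o +
      (c / N) • vecMulVec (fun i => o i h) (fun i => o i h) := by
  ext i j
  have h1 : kernelMap K (o j) = kernelMap (K - c • tensor h h) (o j) + (c * o j h) • h := by
    rw [← kernelMap_smul_tensor]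
    conv_lhs => rw [← sub_add_cancel K (c • tensor h h)]
    exact map_add (kernelMapHom (o j)) _ _
  simp only [Matrix.smul_apply, Matrix.add_apply, gram, of_apply, vecMulVec_apply, smul_eq_mul, h1,
    map_add, map_smul]
  ring

omit [CompactSpace X] in
-- Replacing $f^{(k)}$ by 0 removes the mode while keeping the index set and the eigenvalues, so
-- what is proved for $K$ from its expansion applies to $K_{(k)}$.
theorem hasSum_deflated [DecidableEq ι] (hK : HasSum (fun k => d k • tensor (f k) (f k)) K)
    (k : ι) : HasSum (fun l => d l • tensor (Function.update f k 0 l) (Function.update f k 0 l))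
      (K - d k • tensor (f k) (f k)) := by
  have h := hK.update k 0
  have e : Function.update (fun k => d k • tensor (f k) (f k)) k 0 =
      fun l => d l • tensor (Function.update f k 0 l) (Function.update f k 0 l) := by
    ext1 l
    by_cases hl : l = k
    · subst hl
      ext p
      simp [tensor]
    · simp [hl]
  rw [e, zero_sub, neg_add_eq_sub] at h
  exact h

variable [T2Space X]

theorem posSemidef_smul_gram (hK : HasSum (fun k => d k • tensor (f k) (f k)) K)
    (hd : ∀ k, 0 ≤ d k) (o : Fin N → Observation X) : ((1 / N : ℝ) • gram K o).PosSemidef :=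
  (posSemidef_gram hK hd o).smul (by positivity)

theorem posSemidef_smul_gram_deflated (hK : HasSum (fun k => d k • tensor (f k) (f k)) K)
    (hd : ∀ k, 0 ≤ d k) (o : Fin N → Observation X) (k : ι) :
    ((1 / N : ℝ) • gram (K - d k • tensor (f k) (f k)) o).PosSemidef := by
  classical
  exact posSemidef_smul_gram (hasSum_deflated hK k) hd o

theorem gFun_mem_cone (hK : HasSum (fun k => d k • tensor (f k) (f k)) K)
    (hd : ∀ k, 0 ≤ d k) (hz : z.re < 0) (o : Fin N → Observation X) (k : ι) :
    gFun K (d k) (f k) o z ∈ cone z := by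
  rw [gFun_eq]
  have := mul_mem_cone (r := 1 / N) (by positivity)
    (quad_resolvent_mem_cone (posSemidef_smul_gram_deflated hK hd o k) hz fun i => o i (f k))
  push_cast at this
  exact this

/-- Since $|g_k|\le\frac1{N|z|}\sum_io_i(f^{(k)})^2$, the series is dominated by the expansions of
the diagonal entries $G_{ii}$. -/
theorem summable_mul_norm_gFun (hK : HasSum (fun k => d k • tensor (f k) (f k)) K)
    (hd : ∀ k, 0 ≤ d k) (hz : z.re < 0) (o : Fin N → Observation X) :
    Summable fun k => d k * ‖gFun K (d k) (f k) o z‖ := by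
  have hs : Summable fun k => 1 / (N : ℝ) * (1 / ‖z‖ * ∑ i, d k * o i (f k) * o i (f k)) :=
    ((summable_sum fun i _ => (hasSum_gram hK o i i).summable).mul_left _).mul_left _
  refine .of_nonneg_of_le (fun k => mul_nonneg (hd k) (norm_nonneg _)) (fun k => ?_) hs
  have h := norm_quad_resolvent_le (posSemidef_smul_gram_deflated hK hd o k) hz
    fun i => o i (f k)
  rw [gFun_eq, norm_mul]
  have e : ∑ i, d k * o i (f k) * o i (f k) = d k * ∑ i, o i (f k) ^ 2 := by
    rw [Finset.mul_sum]
    exact Finset.sum_congr rfl fun i _ => by ring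
  have e1 : ‖(1 / N : ℂ)‖ = 1 / N := by simp
  rw [e, e1]
  calc d k * (1 / (N : ℝ) * _) = 1 / (N : ℝ) * (d k * _) := by ring
    _ ≤ 1 / (N : ℝ) * (d k * _) :=
        mul_le_mul_of_nonneg_left (mul_le_mul_of_nonneg_left h (hd k)) (by positivity)
    _ = _ := by ring

/-- The Stieltjes transform as a function of the `g_k`. -/
theorem stieltjes_eq_tsum (hK : HasSum (fun k => d k • tensor (f k) (f k)) K)
    (hd : ∀ k, 0 ≤ d k) (hz : z.re < 0) (hN : 0 < N) (o : Fin N → Observation X) :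
    stieltjes K o z = -(1 / z) * (1 - 1 / N * ∑' k, d k * gFun K (d k) (f k) o z /
      (1 + d k * gFun K (d k) (f k) o z)) := by
  have hN0 : (N : ℂ) ≠ 0 := by exact_mod_cast hN.ne'
  have hz0 := ne_zero_of_re_neg hz
  set M := (1 / N : ℝ) • gram K o with hM
  have hMp : M.PosSemidef := posSemidef_smul_gram hK hd o
  set R := resolvent M z with hR
  -- The same trace is computed twice: here from $RM=1+zR$, then by expanding $M$ into rank-one
  -- modes.
  have h1 : (R * M.map (fun x : ℝ => (x : ℂ))).trace = N + z * R.trace := by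
    have : R * M.map (fun x : ℝ => (x : ℂ)) = 1 + z • R := by
      have := resolvent_spec' hMp hz
      rw [Matrix.mul_sub, Matrix.mul_smul, Matrix.mul_one] at this
      rw [← this]
      abel
    rw [this, trace_add, trace_one, trace_smul, Fintype.card_fin, smul_eq_mul]
  have h2 : HasSum (fun k => ((d k / N : ℝ) : ℂ) * quad R fun i => o i (f k))
      (R * M.map (fun x : ℝ => (x : ℂ))).trace := by
    have : HasSum (fun k => ∑ i, ∑ j, R i j * (((1 / N * (d k * o j (f k) * o i (f k)) : ℝ)) : ℂ))
        (R * M.map (fun x : ℝ => (x : ℂ))).trace :=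
      hasSum_sum fun i _ => hasSum_sum fun j _ =>
        (Complex.hasSum_ofReal.2 ((hasSum_gram hK o j i).mul_left _)).mul_left _
    convert this using 2 with k
    rw [quad, dotProduct, Finset.mul_sum]
    refine Finset.sum_congr rfl fun i _ => ?_
    rw [mulVec, dotProduct, Finset.mul_sum, Finset.mul_sum]
    refine Finset.sum_congr rfl fun j _ => ?_
    simp only [toC]
    push_cast
    ring
  -- Sherman–Morrison trades the full resolvent for the one without mode $k$, which produces
  -- $g_k/(1+d_kg_k)$.
  have h3 : ∀ k, ((d k / N : ℝ) : ℂ) * quad R (fun i => o i (f k)) =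
      d k * gFun K (d k) (f k) o z / (1 + d k * gFun K (d k) (f k) o z) := fun k => by
    have hdN : 0 ≤ d k / N := div_nonneg (hd k) (by positivity)
    rw [hR, quad_resolvent_rankOne (posSemidef_smul_gram_deflated hK hd o k) hMp
      (gram_eq_add K (d k) (f k) o) hz hdN, gFun_eq]
    generalize quad _ _ = q
    push_cast
    rw [mul_div_assoc']
    congr 1
    · ring
    · ring
  simp only [h3] at h2
  rw [h2.tsum_eq, h1, stieltjes_eq]
  field_simp
  ring

theorem norm_stieltjes_sub_le (hK : HasSum (fun k => d k • tensor (f k) (f k)) K)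
    (hd : ∀ k, 0 ≤ d k) (hz : z.re < 0) (o : Fin N → Observation X) (k : ι) :
    ‖stieltjes K o z - stieltjes (K - d k • tensor (f k) (f k)) o z‖ ≤ 1 / N * (2 / ‖z‖) := by
  rw [stieltjes_eq, stieltjes_eq, ← mul_sub, norm_mul]
  have e1 : ‖(1 / N : ℂ)‖ = 1 / N := by simp
  rw [e1]
  exact mul_le_mul_of_nonneg_left (norm_trace_resolvent_rankOne_le
    (posSemidef_smul_gram_deflated hK hd o k) (posSemidef_smul_gram hK hd o)
    (gram_eq_add K (d k) (f k) o) hz (div_nonneg (hd k) (by positivity))) (by positivity)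

variable [Countable ι]

theorem measurable_stieltjes (hK : HasSum (fun k => d k • tensor (f k) (f k)) K) (z : ℂ) :
    Measurable fun o : Fin N → Observation X => stieltjes K o z := by
  simp only [stieltjes_eq]
  refine (measurable_trace_resolvent (fun i j => ?_) z).const_mul _
  exact (measurable_gram_apply hK i j).const_mul (1 / (N : ℝ))

theorem measurable_gFun (hK : HasSum (fun k => d k • tensor (f k) (f k)) K) (z : ℂ) (k : ι) :
    Measurable fun o : Fin N → Observation X => gFun K (d k) (f k) o z := by
  classical
  simp only [gFun_eq]
  refine (measurable_quad_resolvent (fun i j => ?_) (fun i => ?_) z).const_mul _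
  · exact (measurable_gram_apply (hasSum_deflated hK k) i j).const_mul (1 / (N : ℝ))
  · exact (measurable_eval _).comp (measurable_pi_apply i)

variable [IsProbabilityMeasure π]

/-- Given the values $o_i(f^{(l)})$ with $l\ne k$, the deflated matrix is fixed and $\mathcal
O_{\cdot k}$ is still standard Gaussian. The conditional bound is uniform, so it integrates. -/
theorem lintegral_quad_deflated_le (hπ : IsGaussianObservation π)
    (h : IsDiagonalization π K d f) (hN : 0 < N) (hz : z.re < 0) (k : ι) (p : ℕ) :
    ∫⁻ o, ‖quad (resolvent ((1 / N : ℝ) • gram (K - d k • tensor (f k) (f k)) o) z)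
        (fun i => o i (f k)) -
      (resolvent ((1 / N : ℝ) • gram (K - d k • tensor (f k) (f k)) o) z).trace‖ₑ ^ p
        ∂(Measure.pi fun _ : Fin N => π) ≤
      ENNReal.ofReal (8 * p.factorial * (8 * (1 / ‖z‖) * √N) ^ p) := by
  classical
  set F := Function.update f k 0 with hF
  have hK' := hasSum_deflated h.hasSum k
  -- The deflated matrix as a measurable function of the observed values alone, as independence
  -- requires.
  set M : (Fin N → ι → ℝ) → Matrix (Fin N) (Fin N) ℝ := fun Y =>
    (1 / N : ℝ) • of fun i j => ∑' l, d l * Y i l * Y j l with hM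
  have hMm : ∀ i j, Measurable fun q : (Fin N → ℝ) × (Fin N → ι → ℝ) => M q.2 i j := fun i j => by
    refine Measurable.const_mul (c := (1 / (N : ℝ))) (Measurable.tsum fun l => ?_)
    fun_prop
  have hMo : ∀ o : Fin N → Observation X,
      (1 / N : ℝ) • gram (K - d k • tensor (f k) (f k)) o = M fun i l => o i (F l) := fun o => by
    rw [hM]
    congr 1
    ext i j
    exact (hasSum_gram hK' o i j).tsum_eq.symm
  have horth : ∀ l, innerS π (f k) (F l) = 0 := fun l => by
    by_cases hl : l = k
    · subst hl
      simp [hF, innerS]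
    · rw [hF, Function.update_of_ne hl]
      exact h.orthogonal k l (Ne.symm hl)
  have hΦ : Measurable fun q : (Fin N → ℝ) × (Fin N → ι → ℝ) =>
      ‖quad (resolvent (M q.2) z) q.1 - (resolvent (M q.2) z).trace‖ₑ ^ p :=
    ((measurable_quad_resolvent (M := fun q : (Fin N → ℝ) × (Fin N → ι → ℝ) => M q.2)
      (x := fun q => q.1) hMm (fun i => by fun_prop) z).sub
      (measurable_trace_resolvent (M := fun q : (Fin N → ℝ) × (Fin N → ι → ℝ) => M q.2)
        hMm z)).enorm.pow_const p
  simp only [hMo]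
  rw [hπ.lintegral_eq (h.norm_one k) horth hΦ]
  have hle : ∀ o : Fin N → Observation X,
      ∫⁻ x, ‖quad (resolvent (M fun i l => o i (F l)) z) x -
        (resolvent (M fun i l => o i (F l)) z).trace‖ₑ ^ p ∂(stdNormal N) ≤
        ENNReal.ofReal (8 * p.factorial * (8 * (1 / ‖z‖) * √N) ^ p) := fun o => by
    refine lintegral_quad_resolvent_sub_trace_le hN ?_ hz p
    rw [← hMo]
    exact posSemidef_smul_gram hK' h.nonneg o
  refine (lintegral_mono hle).trans_eq ?_
  rw [lintegral_const, measure_univ, mul_one]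

/-- The constant in the moment bounds. -/
def momentConst (p : ℕ) : ℝ := 4 ^ p + 8 * p.factorial * 16 ^ p

/-- The difference passes through the Stieltjes transform of $G_{(k)}$: the rank-one step is
deterministic of order $1/N$, and the Gaussian fluctuation of order $1/\sqrt N$ dominates. -/
theorem lintegral_stieltjes_sub_gFun_le (hπ : IsGaussianObservation π)
    (h : IsDiagonalization π K d f) (hN : 0 < N) (hz : z.re < 0) (k : ι) (s : ℕ) :
    ∫⁻ o, ‖stieltjes K o z - gFun K (d k) (f k) o z‖ₑ ^ (2 * s)
        ∂(Measure.pi fun _ : Fin N => π) ≤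
      ENNReal.ofReal (momentConst (2 * s) / (‖z‖ ^ (2 * s) * (N : ℝ) ^ s)) := by
  have hzn := norm_pos_iff.2 (ne_zero_of_re_neg hz)
  have hNr : (1 : ℝ) ≤ N := by exact_mod_cast hN
  have hs1 : 1 ≤ √(N : ℝ) := Real.one_le_sqrt.2 hNr
  set p := 2 * s with hp
  set Q : (Fin N → Observation X) → ℂ := fun o =>
    quad (resolvent ((1 / N : ℝ) • gram (K - d k • tensor (f k) (f k)) o) z)
        (fun i => o i (f k)) -
      (resolvent ((1 / N : ℝ) • gram (K - d k • tensor (f k) (f k)) o) z).trace with hQ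
  have hpt : ∀ o : Fin N → Observation X, ‖stieltjes K o z - gFun K (d k) (f k) o z‖ ^ p ≤
      2 ^ p * (1 / N * (2 / ‖z‖)) ^ p + 2 ^ p * (1 / N) ^ p * ‖Q o‖ ^ p := fun o => by
    have h1 := norm_stieltjes_sub_le h.hasSum h.nonneg hz o k
    have h2 : ‖stieltjes (K - d k • tensor (f k) (f k)) o z - gFun K (d k) (f k) o z‖ =
        1 / N * ‖Q o‖ := by
      have e1 : ‖(1 / N : ℂ)‖ = 1 / N := by simp
      rw [stieltjes_eq, gFun_eq, ← mul_sub, norm_mul, e1, norm_sub_rev]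
    have h3 := norm_sub_le_norm_sub_add_norm_sub (stieltjes K o z)
      (stieltjes (K - d k • tensor (f k) (f k)) o z) (gFun K (d k) (f k) o z)
    rw [h2] at h3
    calc ‖stieltjes K o z - gFun K (d k) (f k) o z‖ ^ p
        ≤ (1 / N * (2 / ‖z‖) + 1 / N * ‖Q o‖) ^ p :=
          pow_le_pow_left₀ (norm_nonneg _) (h3.trans (add_le_add h1 le_rfl)) p
      _ ≤ 2 ^ (p - 1) * ((1 / N * (2 / ‖z‖)) ^ p + (1 / N * ‖Q o‖) ^ p) :=
          add_pow_le (by positivity) (by positivity) p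
      _ ≤ 2 ^ p * ((1 / N * (2 / ‖z‖)) ^ p + (1 / N * ‖Q o‖) ^ p) :=
          mul_le_mul_of_nonneg_right (pow_le_pow_right₀ one_le_two (Nat.sub_le p 1))
            (by positivity)
      _ = _ := by rw [mul_pow (1 / (N : ℝ)) ‖Q o‖]; ring
  have hpt' : ∀ o : Fin N → Observation X, ‖stieltjes K o z - gFun K (d k) (f k) o z‖ₑ ^ p ≤
      ENNReal.ofReal (2 ^ p * (1 / N * (2 / ‖z‖)) ^ p) +
        ENNReal.ofReal (2 ^ p * (1 / N) ^ p) * ‖Q o‖ₑ ^ p := fun o => by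
    rw [← ofReal_norm, ← ofReal_norm, ← ENNReal.ofReal_pow (norm_nonneg _),
      ← ENNReal.ofReal_pow (norm_nonneg _), ← ENNReal.ofReal_mul (by positivity),
      ← ENNReal.ofReal_add (by positivity) (by positivity)]
    exact ENNReal.ofReal_le_ofReal (hpt o)
  refine (lintegral_mono hpt').trans ?_
  rw [lintegral_add_left measurable_const, lintegral_const, measure_univ, mul_one,
    lintegral_const_mul' _ _ ENNReal.ofReal_ne_top]
  refine (add_le_add le_rfl (mul_le_mul_right
    (lintegral_quad_deflated_le hπ h hN hz k p) _)).trans ?_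
  rw [← ENNReal.ofReal_mul (by positivity), ← ENNReal.ofReal_add (by positivity) (by positivity)]
  refine ENNReal.ofReal_le_ofReal ?_
  have hsq : √(N : ℝ) ^ p = (N : ℝ) ^ s := by
    rw [hp, pow_mul, Real.sq_sqrt (by positivity)]
  have hNN : (N : ℝ) ^ p = (N : ℝ) ^ s * (N : ℝ) ^ s := by rw [hp, two_mul, pow_add]
  have hNs : (1 : ℝ) ≤ (N : ℝ) ^ s := one_le_pow₀ hNr
  -- The rank-one part decays like $N^{-2s}$, more than needed; the surplus factor $N^{-s}$ is
  -- dropped at the end.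
  have e1 : (2 : ℝ) ^ p * (1 / N * (2 / ‖z‖)) ^ p =
      4 ^ p / (‖z‖ ^ p * ((N : ℝ) ^ s * (N : ℝ) ^ s)) := by
    rw [← mul_pow, ← hNN, ← mul_pow, ← div_pow]
    congr 1
    field_simp
    norm_num
  have e2 : (2 : ℝ) ^ p * (1 / N) ^ p * (8 * p.factorial * (8 * (1 / ‖z‖) * √N) ^ p) =
      8 * p.factorial * 16 ^ p / (‖z‖ ^ p * (N : ℝ) ^ s) := by
    have h16 : (16 : ℝ) ^ p = 2 ^ p * 8 ^ p := by rw [← mul_pow]; norm_num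
    rw [mul_pow, mul_pow, hsq, div_pow, div_pow, one_pow, hNN, h16]
    field_simp
  rw [e1, e2, momentConst, add_div]
  refine add_le_add ?_ le_rfl
  refine div_le_div_of_nonneg_left (by positivity) (by positivity) ?_
  refine mul_le_mul_of_nonneg_left ?_ (by positivity)
  exact le_mul_of_one_le_left (by positivity) hNs

end Fluctuation

/-! ### The spectrum of the integral operator -/

section Operator

variable {X : Type*} [TopologicalSpace X] [CompactSpace X] {ι : Type*} {N : ℕ}
  {π : Measure (Observation X)} {K : C(X × X, ℝ)} {d : ι → ℝ} {f : ι → C(X, ℝ)}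

/-- `g ↦ ⟨f, g⟩_S` as a continuous linear form. -/
noncomputable def innerSCLM (hπ : IsGaussianObservation π) (f : C(X, ℝ)) : C(X, ℝ) →L[ℝ] ℝ :=
  (innerSL ℝ (toL2 hπ f)).comp ⟨toL2 hπ, continuous_toL2 hπ⟩

theorem innerSCLM_apply (hπ : IsGaussianObservation π) (f g : C(X, ℝ)) :
    innerSCLM hπ f g = innerS π f g := by
  rw [innerS_eq hπ]
  rfl

theorem innerS_comm (f g : C(X, ℝ)) : innerS π f g = innerS π g f := by
  simp only [innerS, mul_comm]

theorem innerS_smul_right (hπ : IsGaussianObservation π) (c : ℝ) (f g : C(X, ℝ)) :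
    innerS π f (c • g) = c * innerS π f g := by
  rw [← innerSCLM_apply hπ, map_smul, innerSCLM_apply, smul_eq_mul]

theorem IsDiagonalization.abs_innerS_le (hπ : IsGaussianObservation π)
    (h : IsDiagonalization π K d f) (g : C(X, ℝ)) (k : ι) :
    |innerS π g (f k)| ≤ ‖toL2 hπ g‖ := by
  have h1 : ‖toL2 hπ (f k)‖ = 1 := by
    have := h.norm_one k
    rw [innerS_eq hπ, real_inner_self_eq_norm_sq] at this
    exact (pow_eq_one_iff_of_nonneg (norm_nonneg _) two_ne_zero).1 this
  rw [innerS_eq hπ]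
  refine (abs_real_inner_le_norm _ _).trans ?_
  rw [h1, mul_one]

/-- By Cauchy–Schwarz, $(\sum_ta_kd_kf^{(k)}(x))^2\le A^2\sum_td_k\cdot\sum_td_kf^{(k)}(x)^2$. The
last factor is a block of the kernel series on the diagonal, hence small uniformly in $x$. -/
theorem IsDiagonalization.summable_smul (h : IsDiagonalization π K d f) {a : ι → ℝ} {A : ℝ}
    (ha : ∀ k, |a k| ≤ A) : Summable fun k => (a k * d k) • f k := by
  rw [summable_iff_vanishing_norm]
  intro ε hε
  set T := ∑' k, d k with hT
  have hT0 : 0 ≤ T := tsum_nonneg h.nonneg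
  -- The tolerance forces $A^2T\delta<\varepsilon^2$; the summand 1 keeps the denominator positive.
  obtain ⟨s, hs⟩ := summable_iff_vanishing_norm.1 h.hasSum.summable (ε ^ 2 / (A ^ 2 * T + 1))
    (by positivity)
  refine ⟨s, fun t ht => ?_⟩
  have hδ := hs t ht
  set δ := ‖∑ k ∈ t, d k • tensor (f k) (f k)‖ with hδdef
  rw [lt_div_iff₀ (by positivity)] at hδ
  have hδ0 : 0 ≤ δ := norm_nonneg _
  have hlt : √(A ^ 2 * T * δ) < ε := by
    rw [Real.sqrt_lt' hε]
    nlinarith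
  refine lt_of_le_of_lt ((ContinuousMap.norm_le _ (Real.sqrt_nonneg _)).2 fun x => ?_) hlt
  rw [Real.norm_eq_abs]
  refine Real.abs_le_sqrt ?_
  have h1 := Finset.sum_sq_le_sum_mul_sum_of_sq_le_mul t
    (r := fun k => a k * d k * f k x) (f := fun k => A ^ 2 * d k)
    (g := fun k => d k * (f k x * f k x)) (fun k _ => mul_nonneg (sq_nonneg _) (h.nonneg k))
    (fun k _ => mul_nonneg (h.nonneg k) (mul_self_nonneg _)) fun k _ => by
      have h2 : a k ^ 2 ≤ A ^ 2 := by
        rw [← sq_abs (a k)]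
        exact pow_le_pow_left₀ (abs_nonneg _) (ha k) 2
      have h3 : 0 ≤ (d k * f k x) ^ 2 := sq_nonneg _
      nlinarith
  have h4 : ∑ k ∈ t, d k * (f k x * f k x) ≤ δ := by
    have e : (∑ k ∈ t, d k • tensor (f k) (f k)) (x, x) = ∑ k ∈ t, d k * (f k x * f k x) := by
      rw [ContinuousMap.sum_apply]
      rfl
    rw [← e]
    have h7 := ContinuousMap.norm_coe_le_norm (∑ k ∈ t, d k • tensor (f k) (f k)) (x, x)
    rw [Real.norm_eq_abs] at h7
    exact (le_abs_self _).trans h7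
  have h5 : ∑ k ∈ t, A ^ 2 * d k ≤ A ^ 2 * T := by
    rw [← Finset.mul_sum]
    exact mul_le_mul_of_nonneg_left (h.summable.sum_le_tsum t fun k _ => h.nonneg k)
      (sq_nonneg _)
  have h6 : (∑ k ∈ t, (a k * d k) • f k) x = ∑ k ∈ t, a k * d k * f k x := by
    simp [ContinuousMap.sum_apply]
  rw [h6]
  refine h1.trans (mul_le_mul h5 h4 ?_ (by positivity))
  exact Finset.sum_nonneg fun k _ => mul_nonneg (h.nonneg k) (mul_self_nonneg _)

theorem IsDiagonalization.hasSum_integralOperator_apply (hπ : IsGaussianObservation π)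
    (h : IsDiagonalization π K d f) (g : C(X, ℝ)) (x : X) :
    HasSum (fun k => innerS π g (f k) * d k * f k x) (integralOperator hπ K g x) := by
  let e : C(X × X, ℝ) →+ C(X, ℝ) :=
    { toFun := fun K => K.curry x
      map_zero' := rfl
      map_add' := fun _ _ => rfl }
  have he : Continuous e := ContinuousMap.continuous_precomp (⟨fun y => (x, y), by fun_prop⟩ : C(X, X × X))
  have h1 := (h.hasSum.map e he).mapL (innerSCLM hπ g)
  rw [innerSCLM_apply] at h1
  refine h1.congr_fun fun k => ?_
  have h2 : e (d k • tensor (f k) (f k)) = (d k * f k x) • f k := by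
    ext y
    change d k * (f k x * f k y) = d k * f k x * f k y
    ring
  rw [Function.comp_apply, h2, innerSCLM_apply, innerS_smul_right hπ]
  ring

/-- Uniform convergence is given by `summable_smul`, and the pointwise expansion identifies the
limit. -/
theorem IsDiagonalization.hasSum_integralOperator (hπ : IsGaussianObservation π)
    (h : IsDiagonalization π K d f) (g : C(X, ℝ)) :
    HasSum (fun k => (innerS π g (f k) * d k) • f k) (integralOperator hπ K g) := by
  have hs := (h.summable_smul (h.abs_innerS_le hπ g)).hasSum
  convert hs using 1
  ext x
  refine (h.hasSum_integralOperator_apply hπ g x).unique ?_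
  exact ContinuousMap.hasSum_apply hs x

theorem IsDiagonalization.hasSum_innerS (hπ : IsGaussianObservation π)
    (h : IsDiagonalization π K d f) {a : ι → ℝ} {g : C(X, ℝ)}
    (hg : HasSum (fun k => a k • f k) g) (k : ι) : innerS π g (f k) = a k := by
  have h1 := hg.mapL (innerSCLM hπ (f k))
  rw [innerSCLM_apply, innerS_comm] at h1
  refine h1.unique ?_
  have h2 := hasSum_single (f := fun l => innerSCLM hπ (f k) (a l • f l)) k fun l hl => by
    rw [innerSCLM_apply, innerS_smul_right hπ, h.orthogonal k l hl.symm, mul_zero]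
  rwa [innerSCLM_apply, innerS_smul_right hπ, h.norm_one, mul_one] at h2

theorem IsDiagonalization.integralOperator_eigen (hπ : IsGaussianObservation π)
    (h : IsDiagonalization π K d f) (k : ι) : integralOperator hπ K (f k) = d k • f k := by
  refine (h.hasSum_integralOperator hπ (f k)).unique ?_
  have h2 := hasSum_single (f := fun l => (innerS π (f k) (f l) * d l) • f l) k fun l hl => by
    rw [h.orthogonal k l hl.symm, zero_mul, zero_smul]
  rwa [h.norm_one, one_mul] at h2

/-- Needed because `Ring.inverse` is 0 off the units. If $T_Kg=-\vartheta g$, all coefficients of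
$g$ vanish, so $T_Kg=0$ and $g=0$. The family need not be complete: on the part of $g$ orthogonal to
it the inverse is division by $\vartheta$. -/
theorem IsDiagonalization.isUnit_integralOperator_add (hπ : IsGaussianObservation π)
    (h : IsDiagonalization π K d f) {ϑ : ℝ} (hϑ : 0 < ϑ) :
    IsUnit (integralOperator hπ K + ϑ • 1) := by
  have hpos : ∀ k, 0 < d k + ϑ := fun k => add_pos_of_nonneg_of_pos (h.nonneg k) hϑ
  rw [Module.End.isUnit_iff]
  constructor
  · rw [injective_iff_map_eq_zero]
    intro g hg
    have hg' : integralOperator hπ K g = -(ϑ • g) := eq_neg_of_add_eq_zero_left hg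
    have h0 : ∀ k, innerS π g (f k) = 0 := fun k => by
      have h1 := h.hasSum_innerS hπ (h.hasSum_integralOperator hπ g) k
      rw [hg', innerS_comm, ← neg_smul, innerS_smul_right hπ, innerS_comm] at h1
      have : (d k + ϑ) * innerS π g (f k) = 0 := by linarith
      exact (mul_eq_zero.1 this).resolve_left (hpos k).ne'
    have h2 := h.hasSum_integralOperator hπ g
    simp only [h0, zero_mul, zero_smul] at h2
    have h3 := h2.unique hasSum_zero
    rw [h3, zero_eq_neg] at hg'
    exact (smul_eq_zero.1 hg').resolve_left hϑ.ne'
  · intro g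
    have hb : ∀ k, |innerS π g (f k) / (d k + ϑ)| ≤ ‖toL2 hπ g‖ / ϑ := fun k => by
      rw [abs_div, abs_of_pos (hpos k)]
      exact div_le_div₀ (norm_nonneg _) (h.abs_innerS_le hπ g k) hϑ
        (le_add_of_nonneg_left (h.nonneg k))
    obtain ⟨u, hu⟩ := h.summable_smul hb
    have hu' := fun k => h.hasSum_innerS hπ hu k
    -- The preimage, found by solving $T_Kv+\vartheta v=g$ for $v$ once $T_Kv=u$ is known from the
    -- coefficients.
    refine ⟨ϑ⁻¹ • (g - u), ?_⟩
    have h1 : ∀ k, innerS π (ϑ⁻¹ • (g - u)) (f k) = innerS π g (f k) / (d k + ϑ) := fun k => by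
      rw [innerS_comm, innerS_smul_right hπ, ← innerSCLM_apply hπ, map_sub, innerSCLM_apply,
        innerSCLM_apply, innerS_comm (f k), innerS_comm (f k), hu']
      have := (hpos k).ne'
      field_simp
      ring
    have h2 := h.hasSum_integralOperator hπ (ϑ⁻¹ • (g - u))
    simp only [h1] at h2
    rw [LinearMap.add_apply, h2.unique hu, LinearMap.smul_apply, Module.End.one_apply, smul_smul,
      mul_inv_cancel₀ hϑ.ne', one_smul, add_sub_cancel]

theorem IsDiagonalization.traceS_integralOperator (hπ : IsGaussianObservation π)
    (h : IsDiagonalization π K d f) : traceS π f (integralOperator hπ K) = ∑' k, d k := by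
  refine tsum_congr fun k => ?_
  rw [h.integralOperator_eigen hπ, innerS_smul_right hπ, h.norm_one, mul_one]

theorem IsDiagonalization.traceS_mul_inverse (hπ : IsGaussianObservation π)
    (h : IsDiagonalization π K d f) {ϑ : ℝ} (hϑ : 0 < ϑ) :
    traceS π f (integralOperator hπ K * Ring.inverse (integralOperator hπ K + ϑ • 1)) =
      ∑' k, d k / (d k + ϑ) := by
  refine tsum_congr fun k => ?_
  have hpos : 0 < d k + ϑ := add_pos_of_nonneg_of_pos (h.nonneg k) hϑ
  set U := integralOperator hπ K + ϑ • 1 with hU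
  have h1 : U (f k) = (d k + ϑ) • f k := by
    rw [hU, LinearMap.add_apply, h.integralOperator_eigen hπ, LinearMap.smul_apply,
      Module.End.one_apply, add_smul]
  have h2 : Ring.inverse U (f k) = (d k + ϑ)⁻¹ • f k := by
    have h3 : (Ring.inverse U * U) (f k) = f k := by
      rw [Ring.inverse_mul_cancel _ (h.isUnit_integralOperator_add hπ hϑ), Module.End.one_apply]
    rw [Module.End.mul_apply, h1, map_smul] at h3
    rw [← h3, smul_smul, inv_mul_cancel₀ hpos.ne', one_smul, h3]
  rw [Module.End.mul_apply, h2, map_smul, h.integralOperator_eigen hπ, smul_smul,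
    innerS_smul_right hπ, h.norm_one]
  field_simp

/-- The signal capture threshold is the inverse of the fixed point at `z = -lam`. -/
theorem IsDiagonalization.isSCT_iff (hπ : IsGaussianObservation π)
    (h : IsDiagonalization π K d f) {lam : ℝ} (hlam : 0 < lam) {ϑ : ℝ} (hϑ : 0 < ϑ) :
    IsSCT hπ K f N lam ϑ ↔ IsFixedPoint d N (-(lam : ℂ)) (1 / (ϑ : ℂ)) := by
  have hs : ∑' k, (d k : ℂ) * (1 / (ϑ : ℂ)) / (1 + d k * (1 / (ϑ : ℂ))) =
      ((∑' k, d k / (d k + ϑ) : ℝ) : ℂ) := by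
    rw [Complex.ofReal_tsum]
    refine tsum_congr fun k => ?_
    have hpos : 0 < d k + ϑ := add_pos_of_nonneg_of_pos (h.nonneg k) hϑ
    have h1 : (ϑ : ℂ) ≠ 0 := by exact_mod_cast hϑ.ne'
    have h2 : (d k : ℂ) + ϑ ≠ 0 := by exact_mod_cast hpos.ne'
    have h3 : (1 : ℂ) + d k * (1 / ϑ) = (d k + ϑ) / ϑ := by field_simp; ring
    rw [h3]
    push_cast
    field_simp
  have hc : (∃ a b : ℝ, 0 ≤ a ∧ 0 ≤ b ∧ 1 / (ϑ : ℂ) = a - b * (1 / -(lam : ℂ))) :=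
    ⟨1 / ϑ, 0, by positivity, le_rfl, by push_cast; ring⟩
  rw [IsSCT, IsFixedPoint, h.traceS_mul_inverse hπ hϑ, hs]
  simp only [hϑ, hc, true_and]
  set T := ∑' k, d k / (d k + ϑ)
  have e : -(1 / -(lam : ℂ)) * (1 - 1 / N * (T : ℂ)) = ((1 / lam * (1 - 1 / N * T) : ℝ) : ℂ) := by
    push_cast
    rw [one_div_neg_eq_neg_one_div, neg_neg]
  have e2 : 1 / (ϑ : ℂ) = ((1 / ϑ : ℝ) : ℂ) := by push_cast; rfl
  rw [e, e2, Complex.ofReal_inj, one_div_mul_eq_div, div_eq_div_iff hϑ.ne' hlam.ne']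
  constructor
  · intro h1
    linear_combination -h1
  · intro h1
    linear_combination -h1

/-- At $z=-\lambda$ the cone is the half-line $[0,\infty)$, so the fixed point is real, and
$\vartheta$ is its inverse. -/
theorem IsDiagonalization.existsUnique_isSCT (hπ : IsGaussianObservation π)
    (h : IsDiagonalization π K d f) (hN : 0 < N) {lam : ℝ} (hlam : 0 < lam) :
    ∃! ϑ, IsSCT hπ K f N lam ϑ := by
  have hz : (-(lam : ℂ)).re < 0 := by simpa using hlam
  obtain ⟨w, hw, huniq⟩ := existsUnique_isFixedPoint h.nonneg h.summable hz hN
  obtain ⟨a, b, ha, hb, hab⟩ := hw.1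
  have hr : w = ((a + b / lam : ℝ) : ℂ) := by
    rw [hab]
    push_cast
    rw [one_div_neg_eq_neg_one_div]
    ring
  set r := a + b / lam with hrdef
  -- Zero is not a solution: there the right-hand side equals $1/\lambda$.
  have hr0 : 0 < r := by
    refine lt_of_le_of_ne (by positivity) fun h0 => ?_
    have h1 := hw.2
    rw [hr, ← h0] at h1
    simp only [Complex.ofReal_zero, mul_zero, zero_div, tsum_zero, sub_zero, mul_one] at h1
    rw [one_div_neg_eq_neg_one_div, neg_neg] at h1
    exact one_div_ne_zero (Complex.ofReal_ne_zero.2 hlam.ne') h1.symm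
  have hw' : 1 / ((1 / r : ℝ) : ℂ) = w := by
    rw [hr]
    push_cast
    rw [one_div_one_div]
  refine ⟨1 / r, ?_, fun ϑ hϑ => ?_⟩
  · beta_reduce
    rw [h.isSCT_iff hπ hlam (by positivity), hw']
    exact hw
  · have h1 := huniq _ ((h.isSCT_iff hπ hlam hϑ.1).1 hϑ)
    rw [hr] at h1
    have h2 : 1 / ϑ = r := by exact_mod_cast h1
    rw [← h2, one_div_one_div]

end Operator

/-! ### Jensen's inequality and moment bounds -/

section Moments

/-- Jensen's inequality for the weights $w_i$, not normalized. With extended nonnegative values no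
summability has to be checked. -/
theorem tsum_mul_pow_le {ι : Type*} (w a : ι → ENNReal) {p : ℕ} (hp : p ≠ 0) :
    (∑' i, w i * a i) ^ p ≤ (∑' i, w i) ^ (p - 1) * ∑' i, w i * a i ^ p := by
  have hp1 : (1 : ℝ) ≤ p := by exact_mod_cast Nat.one_le_iff_ne_zero.2 hp
  have hp0 : (p : ℝ) ≠ 0 := by exact_mod_cast hp
  have hfin : ∀ t : Finset ι, (∑ i ∈ t, w i * a i) ^ p ≤
      (∑' i, w i) ^ (p - 1) * ∑' i, w i * a i ^ p := fun t => by
    have h := ENNReal.rpow_le_rpow (ENNReal.inner_le_weight_mul_Lp_of_nonneg t hp1 w a)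
      (zero_le_one.trans hp1)
    rw [ENNReal.mul_rpow_of_nonneg _ _ (zero_le_one.trans hp1), ← ENNReal.rpow_mul,
      ← ENNReal.rpow_mul, inv_mul_cancel₀ hp0, ENNReal.rpow_one, sub_mul, inv_mul_cancel₀ hp0,
      one_mul] at h
    have e : (p : ℝ) - 1 = ((p - 1 : ℕ) : ℝ) := by
      rw [Nat.cast_sub (Nat.one_le_iff_ne_zero.2 hp), Nat.cast_one]
    rw [e] at h
    simp only [ENNReal.rpow_natCast] at h
    exact h.trans (mul_le_mul' (pow_le_pow_left' (ENNReal.sum_le_tsum t) _)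
      (ENNReal.sum_le_tsum t))
  exact le_of_tendsto ((ENNReal.continuous_pow p).continuousAt.tendsto.comp
    ENNReal.summable.hasSum) (Eventually.of_forall hfin)

theorem momentLE_of_lintegral {W : Type*} [MeasurableSpace W] {P : Measure W} {F : W → ℂ} {p : ℕ}
    {b : ℝ} (hF : Measurable F) (hb : 0 ≤ b) (h : ∫⁻ w, ‖F w‖ₑ ^ p ∂P ≤ ENNReal.ofReal b) :
    MomentLE P F p b := by
  have e : ∀ w, ‖F w‖ₑ ^ p = ENNReal.ofReal (‖F w‖ ^ p) := fun w => by
    rw [ENNReal.ofReal_pow (norm_nonneg _), ofReal_norm]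
  simp only [e] at h
  have hm : AEStronglyMeasurable (fun w => ‖F w‖ ^ p) P :=
    (hF.norm.pow_const p).aestronglyMeasurable
  have h0 : 0 ≤ᵐ[P] fun w => ‖F w‖ ^ p := Eventually.of_forall fun w => by positivity
  refine ⟨⟨hm, ?_⟩, ?_⟩
  · rw [hasFiniteIntegral_iff_ofReal h0]
    exact h.trans_lt ENNReal.ofReal_lt_top
  · rw [integral_eq_lintegral_of_nonneg_ae h0 hm]
    exact ENNReal.toReal_le_of_le_ofReal hb h

theorem MomentLE.sub_trans {W : Type*} [MeasurableSpace W] {P : Measure W} {F G : W → ℂ} {w : ℂ}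
    {s : ℕ} {a b : ℝ} (hG : Measurable G)
    (h₁ : MomentLE P (fun o => w - F o) (2 * s) a) (h₂ : MomentLE P (fun o => F o - G o) (2 * s) b) :
    MomentLE P (fun o => w - G o) (2 * s)
      ((2 : ℝ) ^ (2 * (s : ℤ) - 1) * a + (2 : ℝ) ^ (2 * (s : ℤ) - 1) * b) := by
  set C := (2 : ℝ) ^ (2 * (s : ℤ) - 1) with hC
  have hpt : ∀ o, ‖w - G o‖ ^ (2 * s) ≤
      C * (‖w - F o‖ ^ (2 * s) + ‖F o - G o‖ ^ (2 * s)) := fun o => by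
    -- For $s=0$ the exponent is $-1$ in ℤ, and $1\le\frac12(1+1)$ holds with equality.
    rcases Nat.eq_zero_or_pos s with hs | hs
    · subst hs
      rw [hC]
      norm_num
    · have e : C = 2 ^ (2 * s - 1) := by
        rw [hC, ← zpow_natCast]
        congr 1
        omega
      rw [e]
      refine (pow_le_pow_left₀ (norm_nonneg _)
        (norm_sub_le_norm_sub_add_norm_sub w (F o) (G o)) _).trans ?_
      exact add_pow_le (norm_nonneg _) (norm_nonneg _) _
  have hint := (h₁.1.add h₂.1).const_mul C
  have hI : Integrable (fun o => ‖w - G o‖ ^ (2 * s)) P := by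
    refine hint.mono' (((measurable_const.sub hG).norm.pow_const _).aestronglyMeasurable)
      (Eventually.of_forall fun o => ?_)
    rw [Real.norm_of_nonneg (by positivity)]
    exact hpt o
  refine ⟨hI, (integral_mono hI hint hpt).trans ?_⟩
  rw [integral_const_mul]
  simp only [Pi.add_apply]
  rw [integral_add h₁.1 h₂.1, ← mul_add]
  exact mul_le_mul_of_nonneg_left (add_le_add h₁.2 h₂.2) (by positivity)

end Moments

/-! ### Moments of the distance to the fixed point -/

section Main

variable {X : Type*} [TopologicalSpace X] [CompactSpace X] [T2Space X] {ι : Type*} [Countable ι]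
  {N : ℕ} {π : Measure (Observation X)} [IsProbabilityMeasure π] {K : C(X × X, ℝ)} {d : ι → ℝ}
  {f : ι → C(X, ℝ)} {z : ℂ}

theorem momentConst_pos (p : ℕ) : 0 < momentConst p := by
  unfold momentConst
  positivity

theorem momentLE_stieltjes_sub_gFun (hπ : IsGaussianObservation π)
    (h : IsDiagonalization π K d f) (hN : 0 < N) (hz : z.re < 0) (k : ι) (s : ℕ) :
    MomentLE (Measure.pi fun _ : Fin N => π)
      (fun o => stieltjes K o z - gFun K (d k) (f k) o z) (2 * s)
      (momentConst (2 * s) / (‖z‖ ^ (2 * s) * (N : ℝ) ^ s)) := by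
  have := momentConst_pos (2 * s)
  exact momentLE_of_lintegral ((measurable_stieltjes h.hasSum z).sub (measurable_gFun h.hasSum z k))
    (by positivity) (lintegral_stieltjes_sub_gFun_le hπ h hN hz k s)

/-- Stability bounds the distance by a $d_k$-weighted sum of the $|m-g_k|$. Jensen and Tonelli then
reduce its moments to those of the single differences, whose bound does not depend on $k$. -/
theorem momentLE_sub_stieltjes (hπ : IsGaussianObservation π)
    (h : IsDiagonalization π K d f) (hN : 0 < N) (hz : z.re < 0) {w : ℂ}
    (hw : IsFixedPoint d N z w) (s : ℕ) :
    MomentLE (Measure.pi fun _ : Fin N => π) (fun o => w - stieltjes K o z) (2 * s)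
      (momentConst (2 * s) * (∑' k, d k) ^ (2 * s) / (‖z‖ ^ (4 * s) * (N : ℝ) ^ (3 * s))) := by
  have hc := momentConst_pos (2 * s)
  have hzn := norm_pos_iff.2 (ne_zero_of_re_neg hz)
  have hNr : (0 : ℝ) < N := by exact_mod_cast hN
  have hT : 0 ≤ ∑' k, d k := tsum_nonneg h.nonneg
  refine momentLE_of_lintegral (measurable_const.sub (measurable_stieltjes h.hasSum z))
    (by positivity) ?_
  -- Jensen needs a positive exponent; for $s=0$ the moment is 1 and the constant is 9.
  rcases Nat.eq_zero_or_pos s with hs | hs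
  · subst hs
    simp only [mul_zero, pow_zero, mul_one, lintegral_const, measure_univ]
    rw [ENNReal.one_le_ofReal]
    norm_num [momentConst]
  set p := 2 * s with hp
  set α := 1 / (‖z‖ * N) with hα
  set b := momentConst p / (‖z‖ ^ p * (N : ℝ) ^ s) with hb
  have hα0 : 0 ≤ α := by positivity
  have hb0 : 0 ≤ b := by positivity
  set D : ι → ENNReal := fun k => ENNReal.ofReal (d k) with hD
  have hDs : ∑' k, D k = ENNReal.ofReal (∑' k, d k) :=
    (ENNReal.ofReal_tsum_of_nonneg h.nonneg h.summable).symm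
  have hpt : ∀ o : Fin N → Observation X, ‖w - stieltjes K o z‖ₑ ^ p ≤
      ENNReal.ofReal α ^ p * ((∑' k, D k) ^ (p - 1) *
        ∑' k, D k * ‖stieltjes K o z - gFun K (d k) (f k) o z‖ₑ ^ p) := fun o => by
    have hgs := summable_mul_norm_gFun h.hasSum h.nonneg hz o
    have h1 := norm_sub_le_of_isFixedPoint h.nonneg h.summable hz hw
      (fun k => gFun_mem_cone h.hasSum h.nonneg hz o k) hgs
      (stieltjes_eq_tsum h.hasSum h.nonneg hz hN o)
    have hs' : Summable fun k => d k * ‖stieltjes K o z - gFun K (d k) (f k) o z‖ := by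
      refine .of_nonneg_of_le (fun k => mul_nonneg (h.nonneg k) (norm_nonneg _)) (fun k => ?_)
        ((h.summable.mul_right ‖stieltjes K o z‖).add hgs)
      rw [← mul_add]
      exact mul_le_mul_of_nonneg_left (norm_sub_le _ _) (h.nonneg k)
    have h2 : ‖w - stieltjes K o z‖ₑ ≤ ENNReal.ofReal α *
        ∑' k, D k * ‖stieltjes K o z - gFun K (d k) (f k) o z‖ₑ := by
      rw [← ofReal_norm]
      refine (ENNReal.ofReal_le_ofReal h1).trans_eq ?_
      rw [ENNReal.ofReal_mul hα0, ENNReal.ofReal_tsum_of_nonneg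
        (fun k => mul_nonneg (h.nonneg k) (norm_nonneg _)) hs']
      congr 1
      exact tsum_congr fun k => by rw [ENNReal.ofReal_mul (h.nonneg k), ofReal_norm]
    refine (pow_le_pow_left' h2 p).trans ?_
    rw [mul_pow]
    exact mul_le_mul' le_rfl (tsum_mul_pow_le _ _ (by omega))
  have hmeas : ∀ k, Measurable fun o : Fin N → Observation X =>
      ‖stieltjes K o z - gFun K (d k) (f k) o z‖ₑ ^ p := fun k =>
    ((measurable_stieltjes h.hasSum z).sub (measurable_gFun h.hasSum z k)).enorm.pow_const p
  refine (lintegral_mono hpt).trans ?_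
  rw [lintegral_const_mul' _ _ (ENNReal.pow_ne_top ENNReal.ofReal_ne_top),
    lintegral_const_mul' _ _ (ENNReal.pow_ne_top (hDs ▸ ENNReal.ofReal_ne_top)),
    lintegral_tsum fun k => ((hmeas k).const_mul _).aemeasurable]
  have hsum : ∑' k, ∫⁻ o, D k * ‖stieltjes K o z - gFun K (d k) (f k) o z‖ₑ ^ p
      ∂(Measure.pi fun _ : Fin N => π) ≤ (∑' k, D k) * ENNReal.ofReal b := by
    rw [← ENNReal.tsum_mul_right]
    refine ENNReal.tsum_le_tsum fun k => ?_
    rw [lintegral_const_mul _ (hmeas k)]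
    exact mul_le_mul' le_rfl (lintegral_stieltjes_sub_gFun_le hπ h hN hz k s)
  refine (mul_le_mul' le_rfl (mul_le_mul' le_rfl hsum)).trans_eq ?_
  rw [← mul_assoc ((∑' k, D k) ^ (p - 1)), ← pow_succ, Nat.sub_add_cancel (by omega), hDs,
    ← ENNReal.ofReal_pow hα0, ← ENNReal.ofReal_pow hT, ← ENNReal.ofReal_mul (by positivity),
    ← ENNReal.ofReal_mul (by positivity)]
  congr 1
  -- The powers add up: $(|z|N)^{-2s}$ from stability and $|z|^{-2s}N^{-s}$ from each difference.
  have e1 : ‖z‖ ^ (4 * s) = ‖z‖ ^ p * ‖z‖ ^ p := by rw [← pow_add]; congr 1; omega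
  have e2 : (N : ℝ) ^ (3 * s) = (N : ℝ) ^ p * (N : ℝ) ^ s := by rw [← pow_add]; congr 1; omega
  rw [e1, e2, hα, hb, div_pow, one_pow, mul_pow]
  field_simp

end Main

end KRR

theorem proposition5 (s : ℕ) :
    ∃ c : ℝ, 0 < c ∧
      ∀ (n : ℕ) (Ω : Set (EuclideanSpace ℝ (Fin n))) [CompactSpace Ω]
        (π : Measure (KRR.Observation Ω)) [IsProbabilityMeasure π]
        (hπ : KRR.IsGaussianObservation π)
        (ι : Type) [Countable ι] (K : C(Ω × Ω, ℝ)) (d : ι → ℝ) (f : ι → C(Ω, ℝ))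
        (_ : KRR.IsDiagonalization π K d f) (N : ℕ) (_ : 0 < N),
        (∀ lam : ℝ, 0 < lam →
          (∃! ϑ : ℝ, KRR.IsSCT hπ K f N lam ϑ) ∧
          ∀ ϑ : ℝ, KRR.IsSCT hπ K f N lam ϑ →
            KRR.MomentLE (Measure.pi fun _ : Fin N => π)
              (fun o => 1 / (ϑ : ℂ) - KRR.stieltjes K o (-(lam : ℂ))) (2 * s)
              (c * (KRR.traceS π f (KRR.integralOperator hπ K)) ^ (2 * s) /
                (lam ^ (4 * s) * (N : ℝ) ^ (3 * s)))) ∧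
        (∀ z : ℂ, z.re < 0 →
          (∃! w : ℂ, KRR.IsFixedPoint d N z w) ∧
          ∀ w : ℂ, KRR.IsFixedPoint d N z w →
            KRR.MomentLE (Measure.pi fun _ : Fin N => π)
              (fun o => w - KRR.stieltjes K o z) (2 * s)
              (c * (KRR.traceS π f (KRR.integralOperator hπ K)) ^ (2 * s) /
                (‖z‖ ^ (4 * s) * (N : ℝ) ^ (3 * s))) ∧
            ∀ k : ι,
              KRR.MomentLE (Measure.pi fun _ : Fin N => π)
                (fun o => KRR.stieltjes K o z - KRR.gFun K (d k) (f k) o z) (2 * s)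
                (c / (‖z‖ ^ (2 * s) * (N : ℝ) ^ s)) ∧
              KRR.MomentLE (Measure.pi fun _ : Fin N => π)
                (fun o => w - KRR.gFun K (d k) (f k) o z) (2 * s)
                ((2 : ℝ) ^ (2 * (s : ℤ) - 1) * c *
                    (KRR.traceS π f (KRR.integralOperator hπ K)) ^ (2 * s) /
                    (‖z‖ ^ (4 * s) * (N : ℝ) ^ (3 * s)) +
                  (2 : ℝ) ^ (2 * (s : ℤ) - 1) * c / (‖z‖ ^ (2 * s) * (N : ℝ) ^ s))) := by
  -- The constant of $m_G-g_k$ serves everywhere, since stability and Jensen introduce no further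
  -- constant.
  refine ⟨KRR.momentConst (2 * s), KRR.momentConst_pos _, ?_⟩
  intro n Ω _ π _ hπ ι _ K d f h N hN
  rw [h.traceS_integralOperator hπ]
  refine ⟨fun lam hlam => ⟨h.existsUnique_isSCT hπ hN hlam, fun ϑ hϑ => ?_⟩, fun z hz =>
    ⟨KRR.existsUnique_isFixedPoint h.nonneg h.summable hz hN, fun w hw => ⟨?_, fun k => ⟨?_, ?_⟩⟩⟩⟩
  · have hz : (-(lam : ℂ)).re < 0 := by simpa using hlam
    have := KRR.momentLE_sub_stieltjes hπ h hN hz ((h.isSCT_iff hπ hlam hϑ.1).1 hϑ) s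
    rwa [norm_neg, Complex.norm_real, Real.norm_of_nonneg hlam.le] at this
  · exact KRR.momentLE_sub_stieltjes hπ h hN hz hw s
  · exact KRR.momentLE_stieltjes_sub_gFun hπ h hN hz k s
  · have := (KRR.momentLE_sub_stieltjes hπ h hN hz hw s).sub_trans
      (KRR.measurable_gFun h.hasSum z k)
      (KRR.momentLE_stieltjes_sub_gFun hπ h hN hz k s)
    rw [← mul_div_assoc, ← mul_div_assoc, ← mul_assoc] at this
    exact this
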